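/- Let $R$ be a field, let $X$, $Y$ be topological spaces and let $f : X \to Y$ be continuous. Write $H^n(-;R)$ for singular cohomology with coefficients in $R$. Let $\mathcal V = (V_i)_{i \in I}$ be a finite open cover of $f(X)$, that is, $I$ is finite, $f(X) \subseteq \bigcup_{i} V_i$, and the $V_i \subseteq Y$ are sets whose traces $V_i \cap f(X)$ are open in $f(X)$ (for instance open subsets of $f(X)$, or open subsets of $Y$). The nerve $N_{\mathcal V}$ is the abstract simplicial complex whose simplices are the non-empty finite sets $\sigma \subseteq I$ with non-empty support $V_\sigma = \bigcap_{i \in \sigma} V_i$. For $n \ge 0$ the Leray cellular sheaf $\mathcal L^n$ on $N_{\mathcal V}$ assigns to a simplex $\sigma$ the $R$-module $\mathcal L^n(\sigma) = H^n(f^{-1}(V_\sigma);R)$, and to a face relation $\sigma \subseteq \tau$ the map $\mathcal L^n_{\sigma\tau}$ induced by the inclusion $f^{-1}(V_\tau) \hookrightarrow f^{-1}(V_\sigma)$; put $\mathcal L^{-1} = 0$. The cohomology $H^k(N_{\mathcal V};\mathcal F)$ of a cellular sheaf $\mathcal F$ is that of the complex $C^k = \bigoplus_{\dim \sigma = k}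 \mathcal F(\sigma)$ with $(\delta\varphi)(\tau) = \sum_{\sigma} [\sigma:\tau]\, \mathcal F_{\sigma\tau}(\varphi(\sigma))$, summed over the facets $\sigma$ of $\tau$, where $[\sigma:\tau] = \pm 1$ is the incidence number for the orientation given by a linear order of $I$. Assume that $N_{\mathcal V}$ is at most one-dimensional. Then, for each integer $n \ge 0$, there is an isomorphism of $R$-vector spaces $$H^n(X;R) \cong H^0(N_{\mathcal V};\mathcal L^n) \oplus H^1(N_{\mathcal V};\mathcal L^{n-1}).$$ -/

import Mathlib

/-! Evaluate the cochains `σ ↦ Cⁿ(f⁻¹(V_σ); R)` on the nerve at a fixed singular simplex lying in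
some `f⁻¹(V_i)`: this gives the cochain complex of a full simplex with vertex `i`, and adding the
vertex `i` contracts it. Hence the Čech complexes of singular cochains are resolutions of the
cochains on small simplices. Restriction from all cochains of `X` to those on small simplices has an
acyclic kernel: if a cocycle vanishes on small simplices, then its iterated subdivisions vanish
eventually on each simplex, and the sum of the subdivision homotopies is a primitive.

When the nerve is at most one-dimensional only two Čech degrees remain, which gives a Mayer–Vietoris
sequence in the cochains of the Leray sheaves. It breaks up into short exact sequences
`0 → H¹(N; Lⁿ) → Hⁿ⁺¹(X) → H⁰(N; Lⁿ⁺¹) → 0`, which split over a field. -/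

noncomputable section

universe u v w

/-! ### Cohomology of a sequence of modules and linear maps -/

section Cohomology

variable {R : Type*} [CommRing R]
  {C : ℕ → Type*} [∀ n, AddCommGroup (C n)] [∀ n, Module R (C n)]
  {D : ℕ → Type*} [∀ n, AddCommGroup (D n)] [∀ n, Module R (D n)]

/-- The coboundaries in degree `n`: the image of the incoming differential (zero in degree `0`). -/
def coboundaries (d : ∀ n, C n →ₗ[R] C (n + 1)) : ∀ n, Submodule R (C n)
  | 0 => ⊥
  | n + 1 => LinearMap.range (d n)

/-- The `n`-th cohomology `ker dⁿ / im dⁿ⁻¹` of the cochain complex `C⁰ → C¹ → C² → ⋯`. -/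
abbrev Cohomology (d : ∀ n, C n →ₗ[R] C (n + 1)) (n : ℕ) : Type _ :=
  LinearMap.ker (d n) ⧸ (coboundaries d n).submoduleOf (LinearMap.ker (d n))

theorem coboundaries_le_comap (d : ∀ n, C n →ₗ[R] C (n + 1)) (e : ∀ n, D n →ₗ[R] D (n + 1))
    (g : ∀ n, C n →ₗ[R] D n) (hg : ∀ n x, e n (g n x) = g (n + 1) (d n x)) (n : ℕ) :
    coboundaries d n ≤ (coboundaries e n).comap (g n) := by
  cases n with
  | zero => exact bot_le
  | succ n =>
    rintro _ ⟨x, rfl⟩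
    exact ⟨g n x, hg n x⟩

/-- The map induced on cocycles by a cochain map `g`. -/
def cocyclesMap (d : ∀ n, C n →ₗ[R] C (n + 1)) (e : ∀ n, D n →ₗ[R] D (n + 1))
    (g : ∀ n, C n →ₗ[R] D n) (hg : ∀ n x, e n (g n x) = g (n + 1) (d n x)) (n : ℕ) :
    LinearMap.ker (d n) →ₗ[R] LinearMap.ker (e n) :=
  (g n).restrict fun x hx => by
    rw [LinearMap.mem_ker] at hx ⊢
    rw [hg, hx, map_zero]

/-- The map induced on cohomology by a cochain map `g`. -/
def Cohomology.map (d : ∀ n, C n →ₗ[R] C (n + 1)) (e : ∀ n, D n →ₗ[R] D (n + 1))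
    (g : ∀ n, C n →ₗ[R] D n) (hg : ∀ n x, e n (g n x) = g (n + 1) (d n x)) (n : ℕ) :
    Cohomology d n →ₗ[R] Cohomology e n :=
  Submodule.mapQ _ _ (cocyclesMap d e g hg n) fun _ hx =>
    coboundaries_le_comap d e g hg n hx

end Cohomology

/-! ### Singular cohomology -/

section Singular

/-- Singular `n`-simplices of `X`: continuous maps from the standard `n`-simplex to `X`. -/
abbrev SingularSimplex (X : Type u) [TopologicalSpace X] (n : ℕ) : Type u :=
  C(stdSimplex ℝ (Fin (n + 1)), X)

/-- The inclusion of the `i`-th face (opposite to the `i`-th vertex) of the standard simplex. -/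
def faceInclusion (n : ℕ) (i : Fin (n + 2)) :
    C(stdSimplex ℝ (Fin (n + 1)), stdSimplex ℝ (Fin (n + 2))) :=
  ⟨stdSimplex.map i.succAbove, stdSimplex.continuous_map _⟩

variable (R : Type w) [CommRing R]

/-- Singular `n`-cochains of `X` with coefficients in `R`: linear functionals on singular chains,
that is, arbitrary `R`-valued functions of singular simplices. -/
abbrev SingularCochain (X : Type u) [TopologicalSpace X] (n : ℕ) : Type (max u w) :=
  SingularSimplex X n → R

/-- The singular coboundary `(δφ)(s) = ∑ᵢ (-1)ⁱ φ(s ∘ dᵢ)`. -/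
def singularCoboundary (X : Type u) [TopologicalSpace X] (n : ℕ) :
    SingularCochain R X n →ₗ[R] SingularCochain R X (n + 1) where
  toFun φ s := ∑ i : Fin (n + 2), (-1 : R) ^ (i : ℕ) * φ (s.comp (faceInclusion n i))
  map_add' φ ψ := by
    ext s
    simp [mul_add, Finset.sum_add_distrib]
  map_smul' c φ := by
    ext s
    simp [Finset.mul_sum, mul_left_comm]

theorem singularCoboundary_comp (X : Type u) [TopologicalSpace X] (n : ℕ)
    (φ : SingularCochain R X n) :
    singularCoboundary R X (n + 1) (singularCoboundary R X n φ) = 0 := by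
  ext s
  simp only [singularCoboundary, LinearMap.coe_mk, AddHom.coe_mk, Finset.mul_sum, Pi.zero_apply]
  rw [← Fintype.sum_prod_type']
  refine Finset.sum_involution (fun p _ => (p.1.succAbove p.2, p.2.predAbove p.1)) ?_ ?_ ?_ ?_
  · rintro ⟨i, j⟩ -
    have h : (s.comp (faceInclusion (n + 1) (i.succAbove j))).comp
        (faceInclusion n (j.predAbove i)) =
        (s.comp (faceInclusion (n + 1) i)).comp (faceInclusion n j) := by
      ext x
      simp only [ContinuousMap.comp_apply, faceInclusion, ContinuousMap.coe_mk,
        stdSimplex.map_comp_apply]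
      congr 2
      ext k : 1
      exact Fin.succAbove_succAbove_succAbove_predAbove i j k
    simp only [h, ← mul_assoc, ← pow_add]
    rw [Fin.neg_one_pow_succAbove_add_predAbove]
    ring
  · rintro ⟨i, j⟩ - - h
    exact Fin.succAbove_ne i j (congrArg Prod.fst h)
  · intros
    exact Finset.mem_univ _
  · rintro ⟨i, j⟩ -
    simp [Fin.succAbove_succAbove_predAbove, Fin.predAbove_predAbove_succAbove]

/-- The `n`-th singular cohomology `Hⁿ(X; R)`. -/
abbrev SingularCohomology (X : Type u) [TopologicalSpace X] (n : ℕ) : Type (max u w) :=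
  Cohomology (singularCoboundary R X) n

/-- Pullback of singular cochains along a continuous map. -/
def singularPullback {X : Type u} {Y : Type v} [TopologicalSpace X] [TopologicalSpace Y]
    (g : C(X, Y)) (n : ℕ) : SingularCochain R Y n →ₗ[R] SingularCochain R X n :=
  LinearMap.funLeft R R fun s => g.comp s

/-- The map `Hⁿ(Y; R) → Hⁿ(X; R)` induced by a continuous map `X → Y`. -/
def SingularCohomology.map {X : Type u} {Y : Type v} [TopologicalSpace X] [TopologicalSpace Y]
    (g : C(X, Y)) (n : ℕ) : SingularCohomology R Y n →ₗ[R] SingularCohomology R X n :=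
  Cohomology.map (singularCoboundary R Y) (singularCoboundary R X) (singularPullback R g)
    (fun _ _ => rfl) n

end Singular

/-! ### Cellular sheaves on simplicial complexes and their cohomology -/

section CellularSheaf

variable (R : Type*) [CommRing R] {ι : Type*}

/-- A cellular sheaf of `R`-modules on an abstract simplicial complex `K`: a module for every
simplex and a restriction map `F(σ) → F(τ)` for every face relation `σ ⊆ τ`, functorially. -/
structure CellularSheaf (K : PreAbstractSimplicialComplex ι) where
  obj : K → Type v
  [addCommGroup : ∀ σ, AddCommGroup (obj σ)]
  [module : ∀ σ, Module R (obj σ)]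
  map : ∀ {σ τ : K}, σ.1 ⊆ τ.1 → (obj σ →ₗ[R] obj τ)
  map_id : ∀ (σ : K) (x : obj σ), map (Finset.Subset.refl σ.1) x = x
  map_comp : ∀ {σ l τ : K} (h : σ.1 ⊆ l.1) (h' : l.1 ⊆ τ.1) (x : obj σ),
    map h' (map h x) = map (h.trans h') x

attribute [instance] CellularSheaf.addCommGroup CellularSheaf.module

variable {R}
variable {K : PreAbstractSimplicialComplex ι}

/-- The `n`-dimensional simplices of `K`: those with `n + 1` vertices. -/
abbrev NSimplex (K : PreAbstractSimplicialComplex ι) (n : ℕ) : Type _ :=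
  {σ : K // σ.1.card = n + 1}

/-- The facet of an `(n + 1)`-simplex opposite to its vertex `v`. -/
def NSimplex.facet [DecidableEq ι] {n : ℕ} (τ : NSimplex K (n + 1)) (v : τ.1.1) :
    NSimplex K n :=
  have hcard : (τ.1.1.erase v.1).card = n + 1 := by
    rw [Finset.card_erase_of_mem v.2, τ.2]
    rfl
  ⟨⟨τ.1.1.erase v.1, (K.isRelLowerSet_faces τ.1.2).2 (Finset.erase_subset _ _)
    (Finset.card_pos.1 (by omega))⟩, hcard⟩

theorem NSimplex.facet_subset [DecidableEq ι] {n : ℕ} (τ : NSimplex K (n + 1)) (v : τ.1.1) :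
    (τ.facet v).1.1 ⊆ τ.1.1 :=
  Finset.erase_subset _ _

/-- The incidence number `[τ ∖ {v} : τ]` for the orientation of simplices given by a linear order
on the vertices: `(-1)^p`, where `p` is the position of `v` in `τ`, counted from `0`. -/
def incidence [LinearOrder ι] (τ : Finset ι) (v : ι) : ℤ :=
  (-1) ^ (τ.filter (· < v)).card

/-- The `n`-cochains of `K` with values in `F`, one element of `F(σ)` for each `n`-simplex `σ`. -/
abbrev SheafCochain (F : CellularSheaf R K) (n : ℕ) : Type _ :=
  ∀ σ : NSimplex K n, F.obj σ.1

/-- The coboundary `(δφ)(τ) = ∑_σ [σ : τ] F_{στ}(φ(σ))`, the sum being over the facets `σ` of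
`τ`. -/
def sheafCoboundary [LinearOrder ι] (F : CellularSheaf R K) (n : ℕ) :
    SheafCochain F n →ₗ[R] SheafCochain F (n + 1) where
  toFun φ τ := ∑ v : τ.1.1, incidence τ.1.1 v.1 •
    F.map (τ.facet_subset v) (φ (τ.facet v))
  map_add' φ ψ := by
    ext τ
    simp [Finset.sum_add_distrib]
  map_smul' c φ := by
    ext τ
    simp only [Pi.smul_apply, map_smul, Finset.smul_sum, RingHom.id_apply]
    exact Finset.sum_congr rfl fun v _ => smul_comm _ _ _

theorem incidence_mul_add [LinearOrder ι] (τ : Finset ι) {a b : ι} (ha : a ∈ τ) (hb : b ∈ τ)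
    (hab : a ≠ b) :
    incidence τ a * incidence (τ.erase a) b + incidence τ b * incidence (τ.erase b) a = 0 := by
  have key : ∀ {a b : ι}, a ∈ τ → a < b →
      incidence τ a * incidence (τ.erase a) b + incidence τ b * incidence (τ.erase b) a = 0 := by
    intro a b ha h
    have h1 : ((τ.erase a).filter (· < b)).card + 1 = (τ.filter (· < b)).card := by
      rw [Finset.filter_erase]
      exact Finset.card_erase_add_one (Finset.mem_filter.2 ⟨ha, h⟩)
    have h2 : (τ.erase b).filter (· < a) = τ.filter (· < a) := by
      rw [Finset.filter_erase]
      exact Finset.erase_eq_of_notMem fun hm => (Finset.mem_filter.1 hm).2.not_gt h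
    simp only [incidence, h2, ← h1, pow_succ]
    ring
  rcases lt_or_gt_of_ne hab with h | h
  · exact key ha h
  · rw [add_comm]
    exact key hb h

theorem sheafCoboundary_comp [LinearOrder ι] (F : CellularSheaf R K) (n : ℕ)
    (φ : SheafCochain F n) :
    sheafCoboundary F (n + 1) (sheafCoboundary F n φ) = 0 := by
  classical
  have key : ∀ (τ : NSimplex K (n + 2)) (ρ ρ' : NSimplex K n) (_ : ρ = ρ')
      (h : ρ.1.1 ⊆ τ.1.1) (h' : ρ'.1.1 ⊆ τ.1.1),
      F.map (σ := ρ.1) (τ := τ.1) h (φ ρ) = F.map (σ := ρ'.1) (τ := τ.1) h' (φ ρ') := by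
    rintro τ ρ _ rfl h h'
    rfl
  ext τ
  simp only [sheafCoboundary, LinearMap.coe_mk, AddHom.coe_mk, map_sum, map_zsmul, F.map_comp,
    Finset.smul_sum, smul_smul, Pi.zero_apply]
  rw [Finset.sum_sigma']
  refine Finset.sum_involution (fun p _ => ⟨⟨p.2.1, Finset.mem_of_mem_erase p.2.2⟩,
    ⟨p.1.1, Finset.mem_erase.2 ⟨(Finset.ne_of_mem_erase p.2.2).symm, p.1.2⟩⟩⟩) ?_ ?_ ?_ ?_
  · rintro ⟨⟨a, ha⟩, ⟨b, hb⟩⟩ -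
    have hb' : b ≠ a := Finset.ne_of_mem_erase hb
    have hbτ : b ∈ τ.1.1 := Finset.mem_of_mem_erase hb
    rw [key τ (NSimplex.facet (τ.facet ⟨b, hbτ⟩) ⟨a, Finset.mem_erase.2 ⟨hb'.symm, ha⟩⟩)
      (NSimplex.facet (τ.facet ⟨a, ha⟩) ⟨b, hb⟩)
      (Subtype.ext (Subtype.ext Finset.erase_right_comm)) _
      ((NSimplex.facet_subset _ _).trans (NSimplex.facet_subset _ _)), ← add_smul]
    convert zero_smul ℤ _
    exact incidence_mul_add _ ha hbτ hb'.symm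
  · rintro ⟨⟨a, ha⟩, ⟨b, hb⟩⟩ - - h
    exact Finset.ne_of_mem_erase hb (congrArg (fun p => p.1.1) h)
  · intros
    simp
  · rintro ⟨⟨a, ha⟩, ⟨b, hb⟩⟩ -
    rfl

/-- The `n`-th cohomology `Hⁿ(K; F)` of `K` with coefficients in the cellular sheaf `F`. -/
abbrev SheafCohomology [LinearOrder ι] (F : CellularSheaf R K) (n : ℕ) : Type _ :=
  Cohomology (sheafCoboundary F) n

end CellularSheaf

/-! ### Nerves and Leray sheaves -/

section Leray

variable {ι : Type*} {Y : Type*}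

/-- The support `V_σ = ⋂_{i ∈ σ} V_i`. -/
def nerveSupport (V : ι → Set Y) (σ : Finset ι) : Set Y :=
  ⋂ i ∈ σ, V i

theorem nerveSupport_anti (V : ι → Set Y) {σ τ : Finset ι} (h : σ ⊆ τ) :
    nerveSupport V τ ⊆ nerveSupport V σ :=
  Set.biInter_subset_biInter_left h

/-- The nerve of a family of sets: the nonempty finite sets of indices with nonempty support. -/
def nerveComplex (V : ι → Set Y) : PreAbstractSimplicialComplex ι where
  faces := {σ | σ.Nonempty ∧ (nerveSupport V σ).Nonempty}
  isRelLowerSet_faces := fun _ h =>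
    ⟨h.1, fun _ hτ hne => ⟨hne, h.2.mono (nerveSupport_anti V hτ)⟩⟩

/-- The Leray cellular sheaf `Lⁿ(σ) = Hⁿ(f⁻¹(V_σ); R)` on the nerve of `V`, with restriction maps
induced by the inclusions `f⁻¹(V_τ) ⊆ f⁻¹(V_σ)` for `σ ⊆ τ`. -/
def leraySheaf (R : Type w) [CommRing R] {X : Type u} [TopologicalSpace X] (f : X → Y)
    (V : ι → Set Y) (n : ℕ) : CellularSheaf.{max u w} R (nerveComplex V) where
  obj σ := SingularCohomology R (f ⁻¹' nerveSupport V σ.1) n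
  map h := SingularCohomology.map R
    (ContinuousMap.inclusion (Set.preimage_mono (nerveSupport_anti V h))) n
  map_id σ x := by
    obtain ⟨x, rfl⟩ := Submodule.Quotient.mk_surjective _ x
    rfl
  map_comp h h' x := by
    obtain ⟨x, rfl⟩ := Submodule.Quotient.mk_surjective _ x
    rfl

end Leray

end

noncomputable section

universe u w

/-! ### Cohomology classes, products and the long exact sequence -/

namespace Cohomology

section Class

variable {R : Type*} [CommRing R]
  {C : ℕ → Type*} [∀ n, AddCommGroup (C n)] [∀ n, Module R (C n)]
  {D : ℕ → Type*} [∀ n, AddCommGroup (D n)] [∀ n, Module R (D n)]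

/-- The map sending a cocycle to its cohomology class. -/
def mk (d : ∀ n, C n →ₗ[R] C (n + 1)) (n : ℕ) : LinearMap.ker (d n) →ₗ[R] Cohomology d n :=
  Submodule.mkQ _

theorem mk_surjective (d : ∀ n, C n →ₗ[R] C (n + 1)) (n : ℕ) : Function.Surjective (mk d n) :=
  Submodule.mkQ_surjective _

theorem mk_eq_zero_iff {d : ∀ n, C n →ₗ[R] C (n + 1)} {n : ℕ} {z : LinearMap.ker (d n)} :
    mk d n z = 0 ↔ (z : C n) ∈ coboundaries d n :=
  Submodule.Quotient.mk_eq_zero _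

theorem mk_zero_injective (d : ∀ n, C n →ₗ[R] C (n + 1)) : Function.Injective (mk d 0) :=
  (injective_iff_map_eq_zero _).2 fun _ hz => Subtype.ext (mk_eq_zero_iff.1 hz)

theorem map_mk {d : ∀ n, C n →ₗ[R] C (n + 1)} {e : ∀ n, D n →ₗ[R] D (n + 1)}
    {g : ∀ n, C n →ₗ[R] D n} (hg : ∀ n x, e n (g n x) = g (n + 1) (d n x)) (n : ℕ)
    (z : LinearMap.ker (d n)) :
    Cohomology.map d e g hg n (mk d n z) = mk e n (cocyclesMap d e g hg n z) :=
  rfl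

theorem coboundaries_le_ker {d : ∀ n, C n →ₗ[R] C (n + 1)} (hd : ∀ n x, d (n + 1) (d n x) = 0)
    (n : ℕ) : coboundaries d n ≤ LinearMap.ker (d n) := by
  cases n with
  | zero => exact bot_le
  | succ n =>
    rintro _ ⟨x, rfl⟩
    exact hd n x

theorem map_coboundaries {d : ∀ n, C n →ₗ[R] C (n + 1)} {e : ∀ n, D n →ₗ[R] D (n + 1)}
    {g : ∀ n, C n →ₗ[R] D n} (hg : ∀ n x, e n (g n x) = g (n + 1) (d n x))
    (hsurj : ∀ n, Function.Surjective (g n)) (n : ℕ) :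
    (coboundaries d n).map (g n) = coboundaries e n := by
  refine le_antisymm (Submodule.map_le_iff_le_comap.2 (coboundaries_le_comap d e g hg n)) ?_
  cases n with
  | zero => exact bot_le
  | succ n =>
    rintro _ ⟨y, rfl⟩
    obtain ⟨x, rfl⟩ := hsurj n y
    exact ⟨d n x, ⟨x, rfl⟩, (hg n x).symm⟩

end Class

section Pi

variable {R : Type*} [CommRing R] {κ : Type*}
  {C : κ → ℕ → Type*} [∀ i n, AddCommGroup (C i n)] [∀ i n, Module R (C i n)]

/-- The comparison map from the cohomology of a product of complexes to the product of the
cohomologies. -/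
def toPi (d : ∀ i n, C i n →ₗ[R] C i (n + 1)) (n : ℕ) :
    Cohomology (fun n => LinearMap.piMap fun i => d i n) n →ₗ[R] ∀ i, Cohomology (d i) n :=
  LinearMap.pi fun i => Cohomology.map (fun n => LinearMap.piMap fun i => d i n) (d i)
    (fun _ => LinearMap.proj i) (fun _ _ => rfl) n

theorem mem_coboundaries_piMap {d : ∀ i n, C i n →ₗ[R] C i (n + 1)} {n : ℕ} {x : ∀ i, C i n}
    (hx : ∀ i, x i ∈ coboundaries (d i) n) :
    x ∈ coboundaries (fun n => LinearMap.piMap fun i => d i n) n := by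
  cases n with
  | zero => exact funext hx
  | succ n =>
    choose y hy using hx
    exact ⟨y, funext hy⟩

theorem toPi_bijective (d : ∀ i n, C i n →ₗ[R] C i (n + 1)) (n : ℕ) :
    Function.Bijective (toPi d n) := by
  constructor
  · refine (injective_iff_map_eq_zero _).2 fun x hx => ?_
    obtain ⟨z, rfl⟩ := mk_surjective _ n x
    exact mk_eq_zero_iff.2 (mem_coboundaries_piMap fun i => mk_eq_zero_iff.1 (congrFun hx i))
  · intro y
    choose z hz using fun i => mk_surjective (d i) n (y i)
    exact ⟨mk _ n ⟨fun i => z i, funext fun i => (z i).2⟩, funext hz⟩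

/-- The cohomology of a product of complexes is the product of their cohomologies. -/
def piEquiv (d : ∀ i n, C i n →ₗ[R] C i (n + 1)) (n : ℕ) :
    Cohomology (fun n => LinearMap.piMap fun i => d i n) n ≃ₗ[R] ∀ i, Cohomology (d i) n :=
  LinearEquiv.ofBijective (toPi d n) (toPi_bijective d n)

end Pi

section LowDegrees

variable {R : Type*} [CommRing R]
  {C : ℕ → Type*} [∀ n, AddCommGroup (C n)] [∀ n, Module R (C n)]
  {D : ℕ → Type*} [∀ n, AddCommGroup (D n)] [∀ n, Module R (D n)]
  {M : Type*} [AddCommGroup M] [Module R M]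

theorem exists_surjective_zero_of_exact {d : ∀ n, C n →ₗ[R] C (n + 1)} {q : M →ₗ[R] C 0}
    (hq : Function.Exact q (d 0)) :
    ∃ p : M →ₗ[R] Cohomology d 0, Function.Surjective p ∧ LinearMap.ker p = LinearMap.ker q := by
  have hmem : ∀ m, q m ∈ LinearMap.ker (d 0) := hq.apply_apply_eq_zero
  refine ⟨mk d 0 ∘ₗ q.codRestrict _ hmem, (mk_surjective d 0).comp ?_, ?_⟩
  · rintro ⟨x, hx⟩
    obtain ⟨m, rfl⟩ := (hq x).1 hx
    exact ⟨m, rfl⟩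
  · rw [LinearMap.ker_comp_of_ker_eq_bot _ (LinearMap.ker_eq_bot.2 (mk_zero_injective d)),
      LinearMap.ker_codRestrict]

theorem exists_injective_one_of_exact {d : ∀ n, C n →ₗ[R] C (n + 1)} {b : C 1 →ₗ[R] M}
    (hb : Function.Exact (d 0) b) (hd : d 1 = 0) :
    ∃ i : Cohomology d 1 →ₗ[R] M,
      Function.Injective i ∧ LinearMap.range i = LinearMap.range b := by
  have hle : (coboundaries d 1).submoduleOf (LinearMap.ker (d 1)) ≤
      LinearMap.ker (b ∘ₗ Submodule.subtype _) := fun z hz => (hb z.1).2 hz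
  refine ⟨Submodule.liftQ _ _ hle, ?_, ?_⟩
  · refine (injective_iff_map_eq_zero _).2 fun x hx => ?_
    obtain ⟨z, rfl⟩ := mk_surjective d 1 x
    exact mk_eq_zero_iff.2 ((hb z.1).1 hx)
  · rw [Submodule.range_liftQ, LinearMap.range_comp, Submodule.range_subtype, hd,
      LinearMap.ker_zero, Submodule.map_top]

end LowDegrees

end Cohomology

section LongExactSequence

variable {R : Type*} [CommRing R]
  {A : ℕ → Type*} [∀ n, AddCommGroup (A n)] [∀ n, Module R (A n)]
  {B : ℕ → Type*} [∀ n, AddCommGroup (B n)] [∀ n, Module R (B n)]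
  {D : ℕ → Type*} [∀ n, AddCommGroup (D n)] [∀ n, Module R (D n)]

/-- A sequence `A → B → D → 0` of cochain complexes which is exact, and in which `A → B` need not
be injective but has an acyclic kernel. Such a sequence has a long exact cohomology sequence. -/
structure IsQuasiShortExact (dA : ∀ n, A n →ₗ[R] A (n + 1)) (dB : ∀ n, B n →ₗ[R] B (n + 1))
    (dD : ∀ n, D n →ₗ[R] D (n + 1)) (ε : ∀ n, A n →ₗ[R] B n) (δ : ∀ n, B n →ₗ[R] D n) : Prop where
  left_comp : ∀ n a, dA (n + 1) (dA n a) = 0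
  mid_comp : ∀ n b, dB (n + 1) (dB n b) = 0
  left_comm : ∀ n a, dB n (ε n a) = ε (n + 1) (dA n a)
  right_comm : ∀ n b, dD n (δ n b) = δ (n + 1) (dB n b)
  exact : ∀ n, Function.Exact (ε n) (δ n)
  surjective : ∀ n, Function.Surjective (δ n)
  acyclic_zero : ∀ a, ε 0 a = 0 → dA 0 a = 0 → a = 0
  acyclic_succ : ∀ n a, ε (n + 1) a = 0 → dA (n + 1) a = 0 → ∃ k, ε n k = 0 ∧ dA n k = a

namespace IsQuasiShortExact

variable {dA : ∀ n, A n →ₗ[R] A (n + 1)} {dB : ∀ n, B n →ₗ[R] B (n + 1)}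
  {dD : ∀ n, D n →ₗ[R] D (n + 1)} {ε : ∀ n, A n →ₗ[R] B n} {δ : ∀ n, B n →ₗ[R] D n}

theorem map_left_zero_injective (h : IsQuasiShortExact dA dB dD ε δ) :
    Function.Injective (Cohomology.map dA dB ε h.left_comm 0) := by
  refine (injective_iff_map_eq_zero _).2 fun x hx => ?_
  obtain ⟨a, rfl⟩ := Cohomology.mk_surjective dA 0 x
  have hεa : ε 0 a = 0 := Cohomology.mk_eq_zero_iff.1 hx
  exact Cohomology.mk_eq_zero_iff.2 (h.acyclic_zero a hεa a.2)

theorem exists_cocycle_of_map_cocycle (h : IsQuasiShortExact dA dB dD ε δ) {n : ℕ} {a : A n}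
    (ha : dB n (ε n a) = 0) : ∃ a', dA n a' = 0 ∧ ε n a' = ε n a := by
  obtain ⟨k, hεk, hk⟩ :=
    h.acyclic_succ n (dA n a) ((h.left_comm n a).symm.trans ha) (h.left_comp n a)
  exact ⟨a - k, by rw [map_sub, hk, sub_self], by rw [map_sub, hεk, sub_zero]⟩

theorem exists_sub_mem_coboundaries (h : IsQuasiShortExact dA dB dD ε δ) {n : ℕ}
    {b : B n} (hb : δ n b ∈ coboundaries dD n) : ∃ a, dB n (ε n a) = dB n b ∧
      b - ε n a ∈ coboundaries dB n := by
  rw [← Cohomology.map_coboundaries h.right_comm h.surjective] at hb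
  obtain ⟨b', hb', hδ⟩ := hb
  obtain ⟨a, ha⟩ := (h.exact n (b - b')).1 (by rw [map_sub, hδ, sub_self])
  have hdb' : dB n b' = 0 := Cohomology.coboundaries_le_ker h.mid_comp n hb'
  exact ⟨a, by rw [ha, map_sub, hdb', sub_zero], by rwa [ha, sub_sub_cancel]⟩

theorem exact_map_mid (h : IsQuasiShortExact dA dB dD ε δ) (n : ℕ) :
    Function.Exact (Cohomology.map dA dB ε h.left_comm n)
      (Cohomology.map dB dD δ h.right_comm n) := by
  intro y
  constructor
  · intro hy
    obtain ⟨⟨b, hb⟩, rfl⟩ := Cohomology.mk_surjective dB n y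
    obtain ⟨a, hda, hab⟩ :=
      h.exists_sub_mem_coboundaries (Cohomology.mk_eq_zero_iff.1 hy)
    obtain ⟨a', ha', hε⟩ := h.exists_cocycle_of_map_cocycle (hda.trans hb)
    refine ⟨Cohomology.mk dA n ⟨a', ha'⟩, Eq.symm (sub_eq_zero.1 ?_)⟩
    rw [Cohomology.map_mk, ← map_sub]
    refine Cohomology.mk_eq_zero_iff.2 ?_
    change b - ε n a' ∈ _
    rwa [hε]
  · rintro ⟨x, rfl⟩
    obtain ⟨a, rfl⟩ := Cohomology.mk_surjective dA n x
    exact Cohomology.mk_eq_zero_iff.2 <| by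
      change δ n (ε n a) ∈ _
      rw [(h.exact n).apply_apply_eq_zero]
      exact zero_mem _

variable (dA dB ε) in
/-- The pairs `(a, b)` consisting of a cocycle `a` of `A` and a primitive `b` of its image in `B`.
The connecting map sends the class of the image of `b` in `D` to the class of `a`. -/
def connectingPairs (n : ℕ) : Submodule R (A (n + 1) × B n) :=
  LinearMap.ker (dA (n + 1) ∘ₗ LinearMap.fst R _ _) ⊓
    LinearMap.eqLocus (ε (n + 1) ∘ₗ LinearMap.fst R _ _) (dB n ∘ₗ LinearMap.snd R _ _)

theorem mem_connectingPairs {n : ℕ} {w : A (n + 1) × B n} :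
    w ∈ connectingPairs dA dB ε n ↔ dA (n + 1) w.1 = 0 ∧ ε (n + 1) w.1 = dB n w.2 :=
  Iff.rfl

variable (dA dB ε) in
/-- The class of `a`, for a pair `(a, b)` as in `connectingPairs`. -/
def connectingPairsLeft (n : ℕ) : connectingPairs dA dB ε n →ₗ[R] Cohomology dA (n + 1) :=
  Cohomology.mk dA (n + 1) ∘ₗ LinearMap.codRestrict _
    (LinearMap.fst R _ _ ∘ₗ Submodule.subtype _) fun w => w.2.1

/-- The class of the image of `b` in `D`, for a pair `(a, b)` as in `connectingPairs`. -/
def connectingPairsRight (h : IsQuasiShortExact dA dB dD ε δ) (n : ℕ) :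
    connectingPairs dA dB ε n →ₗ[R] Cohomology dD n :=
  Cohomology.mk dD n ∘ₗ LinearMap.codRestrict _
    (δ n ∘ₗ LinearMap.snd R _ _ ∘ₗ Submodule.subtype _) fun w => by
      have hw : ε (n + 1) w.1.1 = dB n w.1.2 := w.2.2
      change dD n (δ n w.1.2) = 0
      rw [h.right_comm, ← hw, (h.exact _).apply_apply_eq_zero]

theorem connectingPairsRight_surjective (h : IsQuasiShortExact dA dB dD ε δ) (n : ℕ) :
    Function.Surjective (h.connectingPairsRight n) := by
  intro z
  obtain ⟨⟨z, hz⟩, rfl⟩ := Cohomology.mk_surjective dD n z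
  obtain ⟨b, rfl⟩ := h.surjective n z
  obtain ⟨a, ha⟩ := (h.exact (n + 1) (dB n b)).1 ((h.right_comm n b).symm.trans hz)
  obtain ⟨a', ha', hε⟩ := h.exists_cocycle_of_map_cocycle (a := a) (by rw [ha, h.mid_comp])
  exact ⟨⟨(a', b), ha', hε.trans ha⟩, rfl⟩

theorem ker_connectingPairsRight_le (h : IsQuasiShortExact dA dB dD ε δ) (n : ℕ) :
    LinearMap.ker (h.connectingPairsRight n) ≤
      LinearMap.ker (connectingPairsLeft dA dB ε n) := by
  rintro ⟨⟨a, b⟩, hw⟩ hδb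
  obtain ⟨ha, hab⟩ := mem_connectingPairs.1 hw
  obtain ⟨a₀, ha₀, -⟩ := h.exists_sub_mem_coboundaries (b := b) (Cohomology.mk_eq_zero_iff.1 hδb)
  obtain ⟨k, -, hk⟩ := h.acyclic_succ n (a - dA n a₀)
    (by rw [map_sub, ← h.left_comm, ha₀, hab, sub_self])
    (by rw [map_sub, ha, h.left_comp, sub_self])
  exact Cohomology.mk_eq_zero_iff.2 ⟨a₀ + k, by rw [map_add, hk]; exact add_sub_cancel _ _⟩

/-- The connecting map `Hⁿ(D) → Hⁿ⁺¹(A)`. -/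
def connecting (h : IsQuasiShortExact dA dB dD ε δ) (n : ℕ) :
    Cohomology dD n →ₗ[R] Cohomology dA (n + 1) :=
  Submodule.liftQ _ (connectingPairsLeft dA dB ε n) (h.ker_connectingPairsRight_le n) ∘ₗ
    (LinearMap.quotKerEquivOfSurjective _ (h.connectingPairsRight_surjective n)).symm

theorem connecting_connectingPairsRight (h : IsQuasiShortExact dA dB dD ε δ) (n : ℕ)
    (w : connectingPairs dA dB ε n) :
    h.connecting n (h.connectingPairsRight n w) = connectingPairsLeft dA dB ε n w := by
  rw [connecting, LinearMap.comp_apply, LinearEquiv.coe_coe,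
    LinearMap.quotKerEquivOfSurjective_symm_apply]
  rfl

theorem exact_map_connecting (h : IsQuasiShortExact dA dB dD ε δ) (n : ℕ) :
    Function.Exact (Cohomology.map dB dD δ h.right_comm n) (h.connecting n) := by
  intro z
  constructor
  · obtain ⟨⟨⟨a, b⟩, hw⟩, rfl⟩ := h.connectingPairsRight_surjective n z
    obtain ⟨-, hab⟩ := mem_connectingPairs.1 hw
    rw [connecting_connectingPairsRight]
    intro ha
    obtain ⟨a₀, rfl⟩ : ∃ a₀, dA n a₀ = a := Cohomology.mk_eq_zero_iff.1 ha
    have hcocycle : dB n (b - ε n a₀) = 0 := by rw [map_sub, ← hab, h.left_comm, sub_self]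
    refine ⟨Cohomology.mk dB n ⟨b - ε n a₀, hcocycle⟩, congrArg (Cohomology.mk dD n) ?_⟩
    refine Subtype.ext ((map_sub (δ n) _ _).trans ?_)
    rw [(h.exact n).apply_apply_eq_zero, sub_zero]
    rfl
  · rintro ⟨y, rfl⟩
    obtain ⟨⟨b, hb⟩, rfl⟩ := Cohomology.mk_surjective dB n y
    have hw : (0, b) ∈ connectingPairs dA dB ε n :=
      mem_connectingPairs.2 ⟨map_zero _, (map_zero _).trans (Eq.symm hb)⟩
    exact (h.connecting_connectingPairsRight n ⟨_, hw⟩).trans (map_zero (Cohomology.mk dA (n + 1)))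

theorem exact_connecting_map (h : IsQuasiShortExact dA dB dD ε δ) (n : ℕ) :
    Function.Exact (h.connecting n) (Cohomology.map dA dB ε h.left_comm (n + 1)) := by
  intro x
  constructor
  · intro hx
    obtain ⟨a, rfl⟩ := Cohomology.mk_surjective dA (n + 1) x
    obtain ⟨b, hb⟩ : ∃ b, dB n b = ε (n + 1) a := Cohomology.mk_eq_zero_iff.1 hx
    exact ⟨_, h.connecting_connectingPairsRight n ⟨(a, b), a.2, Eq.symm hb⟩⟩
  · rintro ⟨z, rfl⟩
    obtain ⟨w, rfl⟩ := h.connectingPairsRight_surjective n z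
    rw [connecting_connectingPairsRight]
    exact Cohomology.mk_eq_zero_iff.2 ⟨w.1.2, Eq.symm w.2.2⟩

end IsQuasiShortExact

end LongExactSequence

theorem nonempty_linearEquiv_prod_of_exact {R : Type*} [Ring R] {N M P : Type*}
    [AddCommGroup N] [AddCommGroup M] [AddCommGroup P] [Module R N] [Module R M] [Module R P]
    [Module.Projective R P] {i : N →ₗ[R] M} {p : M →ₗ[R] P} (hi : Function.Injective i)
    (hip : Function.Exact i p) (hp : Function.Surjective p) : Nonempty (M ≃ₗ[R] P × N) := by
  obtain ⟨s, hs⟩ := Module.projective_lifting_property p LinearMap.id hp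
  obtain ⟨e, -⟩ := hip.splitSurjectiveEquiv hi ⟨s, hs⟩
  exact ⟨e ≪≫ₗ LinearEquiv.prodComm R N P⟩

/-! ### Barycentric subdivision of ordered cochains -/

section OrderedCochain

variable (R : Type*) [CommRing R] {E F : Type*}

/-- Ordered `n`-cochains on a set `E`: functions of `(n + 1)`-tuples of points of `E`. -/
abbrev OrderedCochain (E : Type*) (n : ℕ) : Type _ :=
  (Fin (n + 1) → E) → R

/-- The coboundary `(δφ)(v) = ∑ᵢ (-1)ⁱ φ(v ∘ dᵢ)` of ordered cochains. -/
def orderedCoboundary (E : Type*) (n : ℕ) : OrderedCochain R E n →ₗ[R] OrderedCochain R E (n + 1) :=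
  LinearMap.pi fun v => ∑ i : Fin (n + 2), (-1 : R) ^ (i : ℕ) • LinearMap.proj (v ∘ i.succAbove)

variable {R}

theorem orderedCoboundary_apply (n : ℕ) (φ : OrderedCochain R E n) (v : Fin (n + 2) → E) :
    orderedCoboundary R E n φ v =
      ∑ i : Fin (n + 2), (-1 : R) ^ (i : ℕ) * φ (v ∘ i.succAbove) := by
  simp [orderedCoboundary]

variable (R) in
/-- Precomposition with the cone operator `w ↦ (b, w)`. -/
def coneCochain (b : E) (n : ℕ) : OrderedCochain R E (n + 1) →ₗ[R] OrderedCochain R E n :=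
  LinearMap.funLeft R R fun w => (Fin.cons b w : Fin (n + 2) → E)

theorem coneCochain_apply (b : E) (n : ℕ) (φ : OrderedCochain R E (n + 1)) (w : Fin (n + 1) → E) :
    coneCochain R b n φ w = φ (Fin.cons b w : Fin (n + 2) → E) :=
  rfl

theorem coneCochain_orderedCoboundary_apply (b : E) (n : ℕ) (φ : OrderedCochain R E n)
    (w : Fin (n + 1) → E) :
    coneCochain R b n (orderedCoboundary R E n φ) w =
      φ w - ∑ i : Fin (n + 1), (-1 : R) ^ (i : ℕ) * φ (Fin.cons b (i.removeNth w)) := by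
  have hzero : (Fin.cons b w : Fin (n + 2) → E) ∘ Fin.succ = w := rfl
  simp [coneCochain_apply, orderedCoboundary_apply, Fin.sum_univ_succ, hzero, pow_succ,
    sub_eq_add_neg]

theorem coneCochain_orderedCoboundary (b : E) (n : ℕ) (φ : OrderedCochain R E (n + 1)) :
    coneCochain R b (n + 1) (orderedCoboundary R E (n + 1) φ) =
      φ - orderedCoboundary R E n (coneCochain R b n φ) := by
  ext w
  rw [coneCochain_orderedCoboundary_apply, Pi.sub_apply, orderedCoboundary_apply]
  rfl

theorem eq_zero_of_coneCochain_eq_zero {n : ℕ} {φ : OrderedCochain R E (n + 1)}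
    (h : ∀ b, coneCochain R b n φ = 0) : φ = 0 := by
  ext v
  rw [← Fin.cons_self_tail v]
  exact congrFun (h (v 0)) (Fin.tail v)

theorem orderedCoboundary_comp (n : ℕ) (φ : OrderedCochain R E n) :
    orderedCoboundary R E (n + 1) (orderedCoboundary R E n φ) = 0 := by
  induction n with
  | zero =>
    refine eq_zero_of_coneCochain_eq_zero fun b => ?_
    rw [coneCochain_orderedCoboundary, sub_eq_zero]
    have hempty : ∀ u : Fin 0 → E, u = ![] := Matrix.empty_eq
    ext w
    simp [orderedCoboundary_apply, coneCochain_orderedCoboundary_apply, Fin.sum_univ_succ,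
      hempty (Fin.tail (_ : Fin 1 → E)), sub_eq_add_neg]
  | succ n ih =>
    refine eq_zero_of_coneCochain_eq_zero fun b => ?_
    rw [coneCochain_orderedCoboundary, coneCochain_orderedCoboundary, map_sub, ih, sub_zero,
      sub_self]

variable (R) in
/-- The barycentric subdivision operator on ordered cochains, where `β` assigns to a tuple its
barycenter: the dual of `v ↦ β(v) * Sd(∂v)`. -/
def subdivision (β : ∀ n, (Fin (n + 1) → E) → E) :
    ∀ n, OrderedCochain R E n →ₗ[R] OrderedCochain R E n
  | 0 => LinearMap.id
  | n + 1 => LinearMap.pi fun v => LinearMap.proj v ∘ₗ orderedCoboundary R E n ∘ₗ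
      subdivision β n ∘ₗ coneCochain R (β (n + 1) v) n

variable (R) in
/-- The homotopy from the identity to the subdivision: the dual of `v ↦ β(v) * (v - T(∂v))`. -/
def subdivisionHomotopy (β : ∀ n, (Fin (n + 1) → E) → E) :
    ∀ n, OrderedCochain R E (n + 1) →ₗ[R] OrderedCochain R E n
  | 0 => 0
  | n + 1 => LinearMap.pi fun v => LinearMap.proj v ∘ₗ
      (coneCochain R (β (n + 1) v) (n + 1) - orderedCoboundary R E n ∘ₗ
        subdivisionHomotopy β n ∘ₗ coneCochain R (β (n + 1) v) (n + 1))

section Homotopy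

variable (β : ∀ n, (Fin (n + 1) → E) → E)

theorem subdivision_succ_apply (n : ℕ) (φ : OrderedCochain R E (n + 1)) (v : Fin (n + 2) → E) :
    subdivision R β (n + 1) φ v =
      orderedCoboundary R E n (subdivision R β n (coneCochain R (β (n + 1) v) n φ)) v :=
  rfl

theorem subdivisionHomotopy_succ_apply (n : ℕ) (φ : OrderedCochain R E (n + 2))
    (v : Fin (n + 2) → E) :
    subdivisionHomotopy R β (n + 1) φ v = coneCochain R (β (n + 1) v) (n + 1) φ v -
      orderedCoboundary R E n
        (subdivisionHomotopy R β n (coneCochain R (β (n + 1) v) (n + 1) φ)) v :=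
  rfl

theorem subdivisionHomotopy_orderedCoboundary_add (n : ℕ) (φ : OrderedCochain R E (n + 1)) :
    subdivisionHomotopy R β (n + 1) (orderedCoboundary R E (n + 1) φ) +
      orderedCoboundary R E n (subdivisionHomotopy R β n φ) =
        φ - subdivision R β (n + 1) φ := by
  have hδ : ∀ χ : OrderedCochain R E n,
      orderedCoboundary R E n (subdivisionHomotopy R β n (orderedCoboundary R E n χ)) =
        orderedCoboundary R E n χ - orderedCoboundary R E n (subdivision R β n χ) := by
    cases n with
    | zero => simp [subdivisionHomotopy, subdivision]
    | succ n =>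
      intro χ
      rw [← map_sub, ← subdivisionHomotopy_orderedCoboundary_add n χ, map_add,
        orderedCoboundary_comp, add_zero]
  ext v
  rw [Pi.add_apply, Pi.sub_apply, subdivisionHomotopy_succ_apply, coneCochain_orderedCoboundary,
    map_sub, map_sub, hδ, subdivision_succ_apply]
  simp only [Pi.sub_apply]
  ring

end Homotopy

section Naturality

variable (g : E → F)

variable (R) in
/-- Pullback of ordered cochains along a map. -/
def orderedPullback (n : ℕ) : OrderedCochain R F n →ₗ[R] OrderedCochain R E n :=
  LinearMap.funLeft R R fun v => g ∘ v

theorem orderedPullback_apply (n : ℕ) (φ : OrderedCochain R F n) (v : Fin (n + 1) → E) :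
    orderedPullback R g n φ v = φ (g ∘ v) :=
  rfl

theorem orderedCoboundary_orderedPullback (n : ℕ) (φ : OrderedCochain R F n) :
    orderedCoboundary R E n (orderedPullback R g n φ) =
      orderedPullback R g (n + 1) (orderedCoboundary R F n φ) := by
  ext v
  simp only [orderedCoboundary_apply, orderedPullback_apply, Function.comp_assoc]

theorem coneCochain_orderedPullback (b : E) (n : ℕ) (φ : OrderedCochain R F (n + 1)) :
    coneCochain R b n (orderedPullback R g (n + 1) φ) =
      orderedPullback R g n (coneCochain R (g b) n φ) := by
  ext v
  rw [coneCochain_apply, orderedPullback_apply, Fin.comp_cons]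
  rfl

variable {g} {β : ∀ n, (Fin (n + 1) → E) → E} {γ : ∀ n, (Fin (n + 1) → F) → F}

theorem subdivision_orderedPullback
    (hg : ∀ n v, g (β n v) = γ n (g ∘ v)) (n : ℕ) (φ : OrderedCochain R F n) :
    subdivision R β n (orderedPullback R g n φ) =
      orderedPullback R g n (subdivision R γ n φ) := by
  induction n with
  | zero => rfl
  | succ n ih =>
    ext v
    rw [subdivision_succ_apply, coneCochain_orderedPullback, ih,
      orderedCoboundary_orderedPullback, hg]
    rfl

theorem subdivisionHomotopy_orderedPullback
    (hg : ∀ n v, g (β n v) = γ n (g ∘ v)) (n : ℕ) (φ : OrderedCochain R F (n + 1)) :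
    subdivisionHomotopy R β n (orderedPullback R g (n + 1) φ) =
      orderedPullback R g n (subdivisionHomotopy R γ n φ) := by
  induction n with
  | zero => rfl
  | succ n ih =>
    ext v
    rw [subdivisionHomotopy_succ_apply, coneCochain_orderedPullback, ih,
      orderedCoboundary_orderedPullback, hg]
    rfl

end Naturality

section Diameter

variable [PseudoMetricSpace E]

/-- The cochain `φ` vanishes on tuples in `S` whose points have mutual distances at most `r`. -/
def VanishesOnFine {n : ℕ} (φ : OrderedCochain R E n) (S : Set E) (r : ℝ) : Prop :=
  ∀ w : Fin (n + 1) → E, (∀ i, w i ∈ S) → (∀ i j, dist (w i) (w j) ≤ r) → φ w = 0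

theorem VanishesOnFine.orderedCoboundary {n : ℕ} {φ : OrderedCochain R E n} {S : Set E} {r : ℝ}
    (h : VanishesOnFine φ S r) : VanishesOnFine (orderedCoboundary R E n φ) S r := by
  intro w hw hr
  rw [orderedCoboundary_apply]
  refine Finset.sum_eq_zero fun i _ => ?_
  rw [h (w ∘ i.succAbove) (fun k => hw _) (fun k l => hr _ _), mul_zero]

theorem dist_cons_cons_le {n : ℕ} {b : E} {w : Fin (n + 1) → E} {r : ℝ}
    (hb : ∀ i, dist (w i) b ≤ r) (hw : ∀ i j, dist (w i) (w j) ≤ r) (i j : Fin (n + 2)) :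
    dist ((Fin.cons b w : Fin (n + 2) → E) i) ((Fin.cons b w : Fin (n + 2) → E) j) ≤ r := by
  have hr : 0 ≤ r := dist_nonneg.trans (hb 0)
  cases i using Fin.cases <;> cases j using Fin.cases <;> simp only [Fin.cons_zero, Fin.cons_succ]
  · simpa using hr
  · rw [dist_comm]
    exact hb _
  · exact hb _
  · exact hw _ _

variable (β : ∀ n, (Fin (n + 1) → E) → E)

/-- A barycenter operator for which balls are convex and which is as close to the points as the
barycenter in a normed space. -/
structure IsBarycentric : Prop where
  dist_le : ∀ n (w : Fin (n + 1) → E) (x : E) (r : ℝ),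
    (∀ i, dist (w i) x ≤ r) → dist (β n w) x ≤ r
  dist_le_mul : ∀ n (w : Fin (n + 1) → E) (r : ℝ), (∀ i j, dist (w i) (w j) ≤ r) →
    ∀ j, dist (w j) (β n w) ≤ (n / (n + 1) : ℝ) * r

/-- Stability of a set under taking barycenters, the substitute for convexity in a space with a
barycenter operator. -/
def IsBarycenterStable (S : Set E) : Prop :=
  ∀ n (w : Fin (n + 1) → E), (∀ i, w i ∈ S) → β n w ∈ S

variable {β}

theorem IsBarycenterStable.inter_closedBall (hβ : IsBarycentric β) {S : Set E}
    (hS : IsBarycenterStable β S) (x : E) (r : ℝ) :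
    IsBarycenterStable β (S ∩ Metric.closedBall x r) :=
  fun n w hw => ⟨hS n w fun i => (hw i).1, hβ.dist_le n w x r fun i => (hw i).2⟩

theorem vanishesOnFine_subdivision (hβ : IsBarycentric β) {n : ℕ} {φ : OrderedCochain R E n}
    {S : Set E} (hS : IsBarycenterStable β S) {r : ℝ}
    (h : VanishesOnFine φ S ((n / (n + 1) : ℝ) * r)) :
    VanishesOnFine (subdivision R β n φ) S r := by
  induction n generalizing S with
  | zero =>
    intro v hv _
    refine h v hv fun i j => ?_
    rw [Subsingleton.elim (α := Fin 1) i j]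
    simp
  | succ n ih =>
    intro v hv hr
    have hr0 : 0 ≤ r := dist_nonneg.trans (hr 0 0)
    have hfactor : (n / (n + 1) : ℝ) * r ≤ ((n + 1 : ℕ) / ((n + 1 : ℕ) + 1) : ℝ) * r := by
      refine mul_le_mul_of_nonneg_right ?_ hr0
      rw [div_le_div_iff₀ (by positivity) (by positivity)]
      push_cast
      linarith
    have hcone : VanishesOnFine (coneCochain R (β (n + 1) v) n φ)
        (S ∩ Metric.closedBall (β (n + 1) v) (((n + 1 : ℕ) / ((n + 1 : ℕ) + 1) : ℝ) * r))
        ((n / (n + 1) : ℝ) * r) := fun w hw hwr =>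
      h _ (Fin.cases (hS _ _ hv) fun i => (hw i).1)
        (dist_cons_cons_le (fun i => (hw i).2) fun i j => (hwr i j).trans hfactor)
    rw [subdivision_succ_apply]
    exact (ih (hS.inter_closedBall hβ _ _) hcone).orderedCoboundary v
      (fun i => ⟨hv i, hβ.dist_le_mul (n + 1) v r hr i⟩) hr

theorem vanishesOnFine_subdivision_iterate (hβ : IsBarycentric β) {n : ℕ}
    {φ : OrderedCochain R E n} {S : Set E} (hS : IsBarycenterStable β S) (k : ℕ) {r : ℝ}
    (h : VanishesOnFine φ S ((n / (n + 1) : ℝ) ^ k * r)) :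
    VanishesOnFine ((subdivision R β n)^[k] φ) S r := by
  induction k generalizing r with
  | zero => simpa using h
  | succ k ih =>
    rw [Function.iterate_succ_apply']
    refine vanishesOnFine_subdivision hβ hS (ih ?_)
    rwa [← mul_assoc, ← pow_succ]

end Diameter

end OrderedCochain

/-! ### Affine simplices -/

section AffineSimplex

theorem dist_average_le {F : Type*} [SeminormedAddCommGroup F] [NormedSpace ℝ F] {n : ℕ} {r : ℝ}
    (w : Fin (n + 1) → F) (hw : ∀ i j, dist (w i) (w j) ≤ r) (j : Fin (n + 1)) :
    dist (w j) ((n + 1 : ℝ)⁻¹ • ∑ i, w i) ≤ n / (n + 1) * r := by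
  have hdiff : w j - (n + 1 : ℝ)⁻¹ • ∑ i, w i =
      (n + 1 : ℝ)⁻¹ • ∑ i : Fin n, (w j - w (j.succAbove i)) := by
    have hn : (n + 1 : ℝ) ≠ 0 := by positivity
    rw [Fin.sum_univ_succAbove _ j, Finset.sum_sub_distrib, Finset.sum_const, Finset.card_univ,
      Fintype.card_fin, ← Nat.cast_smul_eq_nsmul ℝ]
    match_scalars <;> field_simp
    ring
  have hsum : ‖∑ i : Fin n, (w j - w (j.succAbove i))‖ ≤ n * r := by
    refine (norm_sum_le_of_le _ fun i _ => (dist_eq_norm _ _).symm.trans_le (hw _ _)).trans_eq ?_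
    rw [Finset.sum_const, Finset.card_univ, Fintype.card_fin, nsmul_eq_mul]
  calc dist (w j) ((n + 1 : ℝ)⁻¹ • ∑ i, w i)
      = (n + 1 : ℝ)⁻¹ * ‖∑ i : Fin n, (w j - w (j.succAbove i))‖ := by
        rw [dist_eq_norm, hdiff, norm_smul, Real.norm_of_nonneg (by positivity)]
    _ ≤ (n + 1 : ℝ)⁻¹ * (n * r) := by gcongr
    _ = n / (n + 1) * r := by ring

variable {k n m : ℕ}

/-- The affine singular simplex of a standard simplex with given vertices. -/
def affineSimplex (w : Fin (n + 1) → stdSimplex ℝ (Fin (m + 1))) :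
    C(stdSimplex ℝ (Fin (n + 1)), stdSimplex ℝ (Fin (m + 1))) where
  toFun t := ⟨∑ i, t i • (w i : Fin (m + 1) → ℝ),
    (convex_stdSimplex ℝ _).sum_mem (fun i _ => t.2.1 i) t.2.2 fun i _ => (w i).2⟩
  continuous_toFun := by
    refine Continuous.subtype_mk (continuous_finsetSum _ fun i _ => ?_) _
    exact ((continuous_apply i).comp continuous_subtype_val).smul continuous_const

theorem coe_affineSimplex (w : Fin (n + 1) → stdSimplex ℝ (Fin (m + 1)))
    (t : stdSimplex ℝ (Fin (n + 1))) :
    (affineSimplex w t).1 = ∑ i, t.1 i • (w i).1 :=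
  rfl

theorem affineSimplex_vertex :
    affineSimplex (stdSimplex.vertex : Fin (n + 1) → stdSimplex ℝ (Fin (n + 1))) =
      ContinuousMap.id _ := by
  refine ContinuousMap.ext fun t => Subtype.ext ?_
  rw [coe_affineSimplex]
  funext j
  simp [Finset.sum_apply, Pi.single_apply]

theorem affineSimplex_comp_vertex (w : Fin (n + 1) → stdSimplex ℝ (Fin (m + 1))) :
    affineSimplex w ∘ stdSimplex.vertex = w := by
  refine funext fun j => Subtype.ext ?_
  rw [Function.comp_apply, coe_affineSimplex]
  simp [Pi.single_apply, ite_smul]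

theorem affineSimplex_comp_affineSimplex (v : Fin (n + 1) → stdSimplex ℝ (Fin (m + 1)))
    (w : Fin (k + 1) → stdSimplex ℝ (Fin (n + 1))) :
    (affineSimplex v).comp (affineSimplex w) = affineSimplex (affineSimplex v ∘ w) := by
  refine ContinuousMap.ext fun t => Subtype.ext ?_
  simp only [ContinuousMap.comp_apply, coe_affineSimplex, Function.comp_apply, Finset.sum_apply,
    Pi.smul_apply, Finset.smul_sum, Finset.sum_smul, smul_smul, smul_eq_mul]
  exact Finset.sum_comm

theorem map_eq_affineSimplex (g : Fin (n + 1) → Fin (m + 1)) (t : stdSimplex ℝ (Fin (n + 1))) :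
    stdSimplex.map g t = affineSimplex (stdSimplex.vertex ∘ g) t := by
  refine Subtype.ext (funext fun j => ?_)
  rw [coe_affineSimplex, Finset.sum_apply]
  refine (FunOnFinite.linearMap_apply_apply ℝ ℝ g t.1 j).trans ?_
  simp [Finset.sum_filter, Pi.single_apply, eq_comm]

theorem affineSimplex_comp_faceInclusion (w : Fin (n + 2) → stdSimplex ℝ (Fin (m + 1)))
    (i : Fin (n + 2)) :
    (affineSimplex w).comp (faceInclusion n i) = affineSimplex (w ∘ i.succAbove) := by
  have hface : faceInclusion n i = affineSimplex (stdSimplex.vertex ∘ i.succAbove) :=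
    ContinuousMap.ext fun t => map_eq_affineSimplex i.succAbove t
  rw [hface, affineSimplex_comp_affineSimplex, ← Function.comp_assoc, affineSimplex_comp_vertex]

/-- The barycenter of a tuple of points of a standard simplex. -/
def simplexBarycenter (m n : ℕ) (w : Fin (n + 1) → stdSimplex ℝ (Fin (m + 1))) :
    stdSimplex ℝ (Fin (m + 1)) :=
  affineSimplex w stdSimplex.barycenter

theorem affineSimplex_simplexBarycenter (v : Fin (n + 1) → stdSimplex ℝ (Fin (m + 1)))
    (w : Fin (k + 1) → stdSimplex ℝ (Fin (n + 1))) :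
    affineSimplex v (simplexBarycenter n k w) = simplexBarycenter m k (affineSimplex v ∘ w) := by
  rw [simplexBarycenter, simplexBarycenter, ← affineSimplex_comp_affineSimplex,
    ContinuousMap.comp_apply]

theorem dist_affineSimplex_le (w : Fin (n + 1) → stdSimplex ℝ (Fin (m + 1)))
    (x : stdSimplex ℝ (Fin (m + 1))) {r : ℝ} (h : ∀ i, dist (w i) x ≤ r)
    (t : stdSimplex ℝ (Fin (n + 1))) : dist (affineSimplex w t) x ≤ r :=
  (convex_closedBall x.1 r).sum_mem (fun i _ => t.2.1 i) t.2.2 fun i _ => h i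

theorem isBarycentric_simplexBarycenter : IsBarycentric (simplexBarycenter m) where
  dist_le _ w x _ h := dist_affineSimplex_le w x h _
  dist_le_mul n w r h j := by
    have haverage : (simplexBarycenter m n w).1 = (n + 1 : ℝ)⁻¹ • ∑ i, (w i).1 := by
      rw [simplexBarycenter, coe_affineSimplex, Finset.smul_sum]
      simp
    rw [Subtype.dist_eq, haverage]
    exact dist_average_le (fun i => (w i).1) h j

theorem dist_stdSimplex_le_one (x y : stdSimplex ℝ (Fin (m + 1))) : dist x y ≤ 1 :=
  (Metric.dist_le_diam_of_mem (bounded_stdSimplex _) x.2 y.2).trans diam_stdSimplex_le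

end AffineSimplex

/-! ### Subdivision of singular cochains -/

section SingularSubdivision

variable (R : Type*) [CommRing R] {X : Type*} [TopologicalSpace X]

/-- Evaluation of singular cochains on the affine simplices of a singular simplex. -/
def evalAffine {m : ℕ} (s : SingularSimplex X m) (n : ℕ) :
    SingularCochain R X n →ₗ[R] OrderedCochain R (stdSimplex ℝ (Fin (m + 1))) n :=
  LinearMap.funLeft R R fun w => s.comp (affineSimplex w)

variable (X) in
/-- Barycentric subdivision of singular cochains. -/
def singularSubdivision (n : ℕ) : SingularCochain R X n →ₗ[R] SingularCochain R X n :=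
  LinearMap.pi fun s => LinearMap.proj stdSimplex.vertex ∘ₗ
    subdivision R (simplexBarycenter n) n ∘ₗ evalAffine R s n

variable (X) in
/-- The homotopy from the identity to the subdivision of singular cochains. -/
def singularHomotopy (n : ℕ) : SingularCochain R X (n + 1) →ₗ[R] SingularCochain R X n :=
  LinearMap.pi fun s => LinearMap.proj stdSimplex.vertex ∘ₗ
    subdivisionHomotopy R (simplexBarycenter n) n ∘ₗ evalAffine R s (n + 1)

variable {R}

theorem evalAffine_apply {m : ℕ} (s : SingularSimplex X m) (n : ℕ) (φ : SingularCochain R X n)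
    (w : Fin (n + 1) → stdSimplex ℝ (Fin (m + 1))) :
    evalAffine R s n φ w = φ (s.comp (affineSimplex w)) :=
  rfl

theorem evalAffine_vertex {n : ℕ} (s : SingularSimplex X n) (φ : SingularCochain R X n) :
    evalAffine R s n φ stdSimplex.vertex = φ s := by
  rw [evalAffine_apply, affineSimplex_vertex, ContinuousMap.comp_id]

theorem ext_evalAffine {n : ℕ} {φ ψ : SingularCochain R X n}
    (h : ∀ s : SingularSimplex X n, evalAffine R s n φ = evalAffine R s n ψ) : φ = ψ := by
  ext s
  rw [← evalAffine_vertex s φ, h s, evalAffine_vertex]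

theorem orderedCoboundary_evalAffine {m : ℕ} (s : SingularSimplex X m) (n : ℕ)
    (φ : SingularCochain R X n) :
    orderedCoboundary R _ n (evalAffine R s n φ) =
      evalAffine R s (n + 1) (singularCoboundary R X n φ) := by
  ext w
  simp only [orderedCoboundary_apply, evalAffine_apply, singularCoboundary, LinearMap.coe_mk,
    AddHom.coe_mk, ContinuousMap.comp_assoc, affineSimplex_comp_faceInclusion]

theorem evalAffine_comp_affineSimplex {m k : ℕ} (s : SingularSimplex X m)
    (w : Fin (k + 1) → stdSimplex ℝ (Fin (m + 1))) (n : ℕ) (φ : SingularCochain R X n) :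
    evalAffine R (s.comp (affineSimplex w)) n φ =
      orderedPullback R (affineSimplex w) n (evalAffine R s n φ) := by
  ext v
  rw [orderedPullback_apply, evalAffine_apply, evalAffine_apply, ContinuousMap.comp_assoc,
    affineSimplex_comp_affineSimplex]

theorem evalAffine_singularSubdivision {m : ℕ} (s : SingularSimplex X m) (n : ℕ)
    (φ : SingularCochain R X n) :
    evalAffine R s n (singularSubdivision R X n φ) =
      subdivision R (simplexBarycenter m) n (evalAffine R s n φ) := by
  ext w
  change subdivision R _ n (evalAffine R (s.comp (affineSimplex w)) n φ) stdSimplex.vertex = _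
  rw [evalAffine_comp_affineSimplex,
    subdivision_orderedPullback fun _ => affineSimplex_simplexBarycenter w, orderedPullback_apply,
    affineSimplex_comp_vertex]

theorem evalAffine_singularHomotopy {m : ℕ} (s : SingularSimplex X m) (n : ℕ)
    (φ : SingularCochain R X (n + 1)) :
    evalAffine R s n (singularHomotopy R X n φ) =
      subdivisionHomotopy R (simplexBarycenter m) n (evalAffine R s (n + 1) φ) := by
  ext w
  change subdivisionHomotopy R _ n (evalAffine R (s.comp (affineSimplex w)) (n + 1) φ)
    stdSimplex.vertex = _
  rw [evalAffine_comp_affineSimplex,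
    subdivisionHomotopy_orderedPullback fun _ => affineSimplex_simplexBarycenter w,
    orderedPullback_apply, affineSimplex_comp_vertex]

theorem evalAffine_singularSubdivision_iterate {m : ℕ} (s : SingularSimplex X m) (n k : ℕ)
    (φ : SingularCochain R X n) :
    evalAffine R s n ((singularSubdivision R X n)^[k] φ) =
      (subdivision R (simplexBarycenter m) n)^[k] (evalAffine R s n φ) :=
  Function.Semiconj.iterate_right (evalAffine_singularSubdivision s n) k φ

theorem singularHomotopy_singularCoboundary_add (n : ℕ) (φ : SingularCochain R X (n + 1)) :
    singularHomotopy R X (n + 1) (singularCoboundary R X (n + 1) φ) +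
      singularCoboundary R X n (singularHomotopy R X n φ) =
        φ - singularSubdivision R X (n + 1) φ := by
  refine ext_evalAffine fun s => ?_
  rw [map_add, map_sub, evalAffine_singularHomotopy, evalAffine_singularSubdivision,
    ← orderedCoboundary_evalAffine, ← orderedCoboundary_evalAffine, evalAffine_singularHomotopy,
    subdivisionHomotopy_orderedCoboundary_add]

theorem singularCoboundary_singularHomotopy {n : ℕ} {φ : SingularCochain R X (n + 1)}
    (hφ : singularCoboundary R X (n + 1) φ = 0) :
    singularCoboundary R X n (singularHomotopy R X n φ) =
      φ - singularSubdivision R X (n + 1) φ := by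
  rw [← singularHomotopy_singularCoboundary_add, hφ, map_zero, zero_add]

theorem singularCoboundary_singularSubdivision_iterate {n : ℕ} {φ : SingularCochain R X (n + 1)}
    (hφ : singularCoboundary R X (n + 1) φ = 0) (k : ℕ) :
    singularCoboundary R X (n + 1) ((singularSubdivision R X (n + 1))^[k] φ) = 0 := by
  induction k with
  | zero => exact hφ
  | succ k ih =>
    rw [Function.iterate_succ_apply']
    have h := congrArg (singularCoboundary R X (n + 1)) (singularCoboundary_singularHomotopy ih)
    rwa [singularCoboundary_comp, map_sub, ih, zero_sub, eq_comm, neg_eq_zero] at h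

theorem singularCoboundary_sum_singularHomotopy {n : ℕ} {φ : SingularCochain R X (n + 1)}
    (hφ : singularCoboundary R X (n + 1) φ = 0) (k : ℕ) :
    singularCoboundary R X n (∑ j ∈ Finset.range k,
      singularHomotopy R X n ((singularSubdivision R X (n + 1))^[j] φ)) =
        φ - (singularSubdivision R X (n + 1))^[k] φ := by
  rw [map_sum]
  refine Eq.trans (Finset.sum_congr rfl fun j _ => ?_)
    (Finset.sum_range_sub' (fun j => (singularSubdivision R X (n + 1))^[j] φ) k)
  rw [singularCoboundary_singularHomotopy (singularCoboundary_singularSubdivision_iterate hφ j),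
    Function.iterate_succ_apply']

end SingularSubdivision

/-! ### Small simplices -/

section Small

variable {R : Type*} [CommRing R] {X : Type*} [TopologicalSpace X] {ι : Type*}

/-- A singular simplex is small for a family of sets if it lies in one of them. -/
def IsSmallSimplex (U : ι → Set X) {n : ℕ} (s : SingularSimplex X n) : Prop :=
  ∃ i, ∀ t, s t ∈ U i

/-- A singular cochain vanishing on the simplices that are small for a family of sets. -/
def VanishesOnSmall (U : ι → Set X) {n : ℕ} (φ : SingularCochain R X n) : Prop :=
  ∀ s, IsSmallSimplex U s → φ s = 0

/-- The sum of the homotopies between the successive subdivisions of `φ`. It is meaningful when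
the iterated subdivisions of `φ` vanish eventually on every simplex: an infinite `finsum` is `0`. -/
def totalHomotopy {n : ℕ} (φ : SingularCochain R X (n + 1)) : SingularCochain R X n :=
  fun s => ∑ᶠ j, singularHomotopy R X n ((singularSubdivision R X (n + 1))^[j] φ) s

theorem evalAffine_totalHomotopy {m n K : ℕ} {s : SingularSimplex X m}
    {φ : SingularCochain R X (n + 1)}
    (hK : evalAffine R s (n + 1) ((singularSubdivision R X (n + 1))^[K] φ) = 0) :
    evalAffine R s n (totalHomotopy φ) = evalAffine R s n (∑ j ∈ Finset.range K,
      singularHomotopy R X n ((singularSubdivision R X (n + 1))^[j] φ)) := by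
  have hvanish : ∀ j ≥ K,
      evalAffine R s n (singularHomotopy R X n ((singularSubdivision R X (n + 1))^[j] φ)) = 0 := by
    intro j hj
    obtain ⟨i, rfl⟩ := Nat.exists_eq_add_of_le' hj
    rw [evalAffine_singularHomotopy, Function.iterate_add_apply,
      evalAffine_singularSubdivision_iterate, hK, iterate_map_zero, map_zero]
  ext w
  rw [evalAffine_apply, evalAffine_apply, Finset.sum_apply]
  refine finsum_eq_sum_of_support_subset _ fun j hj => ?_
  rw [Finset.coe_range, Set.mem_Iio]
  by_contra! hle
  exact hj (congrFun (hvanish j hle) w)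

variable {U : ι → Set X}

theorem VanishesOnSmall.evalAffine_eq_zero {m n : ℕ} {φ : SingularCochain R X n}
    (hφ : VanishesOnSmall U φ) {s : SingularSimplex X m} (hs : IsSmallSimplex U s) :
    evalAffine R s n φ = 0 := by
  obtain ⟨i, hi⟩ := hs
  exact funext fun w => hφ _ ⟨i, fun t => hi _⟩

theorem VanishesOnSmall.exists_vanishesOnFine (hU : ∀ i, IsOpen (U i))
    (hcover : ⋃ i, U i = Set.univ) {m n : ℕ} (s : SingularSimplex X m) {φ : SingularCochain R X n}
    (hφ : VanishesOnSmall U φ) : ∃ r > 0, VanishesOnFine (evalAffine R s n φ) Set.univ r := by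
  obtain ⟨δ, hδ, hball⟩ := lebesgue_number_lemma_of_metric (c := fun i => s ⁻¹' U i)
    (isCompact_univ (X := stdSimplex ℝ (Fin (m + 1)))) (fun i => (hU i).preimage s.continuous)
    (by rw [← Set.preimage_iUnion, hcover, Set.preimage_univ])
  refine ⟨δ / 2, half_pos hδ, fun w _ hw => ?_⟩
  obtain ⟨i, hi⟩ := hball (w 0) (Set.mem_univ _)
  refine hφ _ ⟨i, fun t => hi ?_⟩
  exact (dist_affineSimplex_le w (w 0) (fun j => hw j 0) t).trans_lt (half_lt_self hδ)

theorem VanishesOnSmall.exists_iterate_eq_zero (hU : ∀ i, IsOpen (U i))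
    (hcover : ⋃ i, U i = Set.univ) {m n : ℕ} (s : SingularSimplex X m) {φ : SingularCochain R X n}
    (hφ : VanishesOnSmall U φ) :
    ∃ k, evalAffine R s n ((singularSubdivision R X n)^[k] φ) = 0 := by
  obtain ⟨r, hr, hfine⟩ := hφ.exists_vanishesOnFine hU hcover s
  have hlt : (n / (n + 1) : ℝ) < 1 := (div_lt_one (by positivity)).2 (lt_add_one _)
  obtain ⟨k, hk⟩ := exists_pow_lt_of_lt_one hr hlt
  have hvanish : VanishesOnFine ((subdivision R (simplexBarycenter m) n)^[k] (evalAffine R s n φ))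
      Set.univ 1 :=
    vanishesOnFine_subdivision_iterate isBarycentric_simplexBarycenter
      (fun _ _ _ => Set.mem_univ _) k fun w hw hwr => hfine w hw fun i j =>
        (hwr i j).trans ((mul_one _).trans_le hk.le)
  refine ⟨k, funext fun w => ?_⟩
  rw [evalAffine_singularSubdivision_iterate]
  exact hvanish w (fun _ => Set.mem_univ _) fun _ _ => dist_stdSimplex_le_one _ _

theorem VanishesOnSmall.eq_zero_of_zero (hcover : ⋃ i, U i = Set.univ)
    {φ : SingularCochain R X 0} (hφ : VanishesOnSmall U φ) : φ = 0 := by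
  ext s
  obtain ⟨i, hi⟩ := Set.mem_iUnion.1 (hcover.ge (Set.mem_univ (s default)))
  exact hφ s ⟨i, fun t => by rwa [Subsingleton.elim t default]⟩

theorem vanishesOnSmall_totalHomotopy {n : ℕ} {φ : SingularCochain R X (n + 1)}
    (hφ : VanishesOnSmall U φ) : VanishesOnSmall U (totalHomotopy φ) := by
  intro s hs
  have hzero : evalAffine R s (n + 1) ((singularSubdivision R X (n + 1))^[0] φ) = 0 :=
    hφ.evalAffine_eq_zero hs
  rw [← evalAffine_vertex s (totalHomotopy φ), evalAffine_totalHomotopy hzero,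
    Finset.sum_range_zero, map_zero, Pi.zero_apply]

theorem VanishesOnSmall.singularCoboundary_totalHomotopy (hU : ∀ i, IsOpen (U i))
    (hcover : ⋃ i, U i = Set.univ) {n : ℕ} {φ : SingularCochain R X (n + 1)}
    (hφ : VanishesOnSmall U φ) (hcocycle : singularCoboundary R X (n + 1) φ = 0) :
    singularCoboundary R X n (totalHomotopy φ) = φ := by
  refine ext_evalAffine fun s => ?_
  obtain ⟨k, hk⟩ := hφ.exists_iterate_eq_zero hU hcover s
  rw [← orderedCoboundary_evalAffine, evalAffine_totalHomotopy hk, orderedCoboundary_evalAffine,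
    singularCoboundary_sum_singularHomotopy hcocycle, map_sub, hk, sub_zero]

end Small

/-! ### The Čech rows -/

section FinsetCochain

variable {M : Type*} [AddCommGroup M] {ι : Type*} [LinearOrder ι]

/-- The simplicial coboundary of a function on all finite sets of vertices, in every degree at
once. It extends the coboundary of cellular sheaves with constant values. -/
def finsetCoboundary (g : Finset ι → M) (τ : Finset ι) : M :=
  ∑ v ∈ τ, incidence τ v • g (τ.erase v)

/-- The contracting homotopy of `finsetCoboundary` given by adding the vertex `i`. -/
def finsetCone (i : ι) (g : Finset ι → M) (σ : Finset ι) : M :=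
  if i ∈ σ then 0 else incidence (insert i σ) i • g (insert i σ)

theorem incidence_mul_self (τ : Finset ι) (v : ι) : incidence τ v * incidence τ v = 1 := by
  rw [incidence, ← mul_pow, neg_one_mul, neg_neg, one_pow]

theorem incidence_singleton (i : ι) : incidence {i} i = 1 := by
  rw [incidence, Finset.filter_singleton, if_neg (lt_irrefl i), Finset.card_empty, pow_zero]

theorem sum_incidence_of_card_eq_two {τ : Finset ι} (hτ : τ.card = 2) :
    ∑ v ∈ τ, incidence τ v = 0 := by
  obtain ⟨i, j, hij, rfl⟩ := Finset.card_eq_two.1 hτ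
  have hj : ({i, j} : Finset ι).erase j = {i} := by
    rw [Finset.pair_comm, Finset.erase_insert (Finset.notMem_singleton.2 hij.symm)]
  have h := incidence_mul_add {i, j} (Finset.mem_insert_self i _)
    (Finset.mem_insert_of_mem (Finset.mem_singleton_self j)) hij
  rwa [Finset.erase_insert (Finset.notMem_singleton.2 hij), hj, incidence_singleton,
    incidence_singleton, mul_one, mul_one, ← Finset.sum_pair hij] at h

theorem finsetCoboundary_of_card_eq_one {σ : Finset ι} (hσ : σ.card = 1) (g : Finset ι → M) :
    finsetCoboundary g σ = g ∅ := by
  obtain ⟨i, rfl⟩ := Finset.card_eq_one.1 hσ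
  rw [finsetCoboundary, Finset.sum_singleton, incidence_singleton, one_smul,
    Finset.erase_singleton]

theorem finsetCoboundary_finsetCone_of_mem {i : ι} {τ : Finset ι} (hi : i ∈ τ)
    (g : Finset ι → M) : finsetCoboundary (finsetCone i g) τ = g τ := by
  rw [finsetCoboundary, Finset.sum_eq_single_of_mem i hi, finsetCone,
    if_neg (Finset.notMem_erase i τ), Finset.insert_erase hi, smul_smul, incidence_mul_self,
    one_smul]
  intro v _ hv
  rw [finsetCone, if_pos (Finset.mem_erase.2 ⟨hv.symm, hi⟩), smul_zero]

theorem finsetCoboundary_finsetCone_add (i : ι) (g : Finset ι → M) (τ : Finset ι) :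
    finsetCoboundary (finsetCone i g) τ + finsetCone i (finsetCoboundary g) τ = g τ := by
  by_cases hi : i ∈ τ
  · rw [finsetCoboundary_finsetCone_of_mem hi, finsetCone, if_pos hi, add_zero]
  rw [finsetCone, if_neg hi, finsetCoboundary, finsetCoboundary, Finset.sum_insert hi,
    Finset.erase_insert hi, smul_add, smul_smul, incidence_mul_self, one_smul, add_left_comm,
    Finset.smul_sum, ← Finset.sum_add_distrib, Finset.sum_eq_zero, add_zero]
  intro v hv
  have hvi : v ≠ i := ne_of_mem_of_not_mem hv hi
  have hsign := incidence_mul_add (insert i τ) (Finset.mem_insert_self i τ)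
    (Finset.mem_insert_of_mem hv) hvi.symm
  rw [Finset.erase_insert hi] at hsign
  rw [finsetCone, if_neg fun h => hi (Finset.mem_of_mem_erase h),
    ← Finset.erase_insert_of_ne hvi.symm, smul_smul, smul_smul, ← add_smul]
  convert zero_smul ℤ _
  linear_combination incidence (insert i τ) i * incidence ((insert i τ).erase v) i * hsign -
    incidence τ v * incidence ((insert i τ).erase v) i * incidence_mul_self (insert i τ) i -
    incidence (insert i τ) i * incidence (insert i τ) v *
      incidence_mul_self ((insert i τ).erase v) i

end FinsetCochain

section CechRow

variable (R : Type w) [CommRing R] {X : Type u} [TopologicalSpace X] {Y : Type*} (f : X → Y)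
  {ι : Type*} (V : ι → Set Y)

/-- The cellular sheaf of singular cochains `σ ↦ Cⁿ(f⁻¹(V_σ); R)`. -/
abbrev cochainSheaf (n : ℕ) : CellularSheaf.{max u w} R (nerveComplex V) where
  obj σ := SingularCochain R (f ⁻¹' nerveSupport V σ.1) n
  map h := singularPullback R
    (ContinuousMap.inclusion (Set.preimage_mono (nerveSupport_anti V h))) n
  map_id _ _ := rfl
  map_comp _ _ _ := rfl

/-- Restriction of singular cochains of `X` to the sets `f⁻¹(V_i)`. -/
def restrictToVertices (n : ℕ) :
    SingularCochain R X n →ₗ[R] SheafCochain (cochainSheaf R f V n) 0 :=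
  LinearMap.pi fun σ =>
    singularPullback R (⟨Subtype.val, continuous_subtype_val⟩ : C(f ⁻¹' nerveSupport V σ.1.1, X)) n

/-- The simplexwise singular coboundary. -/
def simplexwiseCoboundary (k n : ℕ) :
    SheafCochain (cochainSheaf R f V n) k →ₗ[R] SheafCochain (cochainSheaf R f V (n + 1)) k :=
  LinearMap.piMap fun σ => singularCoboundary R (f ⁻¹' nerveSupport V σ.1.1) n

variable {R f V} {n k : ℕ}

/-- A singular simplex as a singular simplex of a subset containing its image. -/
def liftSimplex {U : Set X} (s : SingularSimplex X n) (h : ∀ t, s t ∈ U) : SingularSimplex U n :=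
  ⟨fun t => ⟨s t, h t⟩, s.continuous.subtype_mk h⟩

/-- A singular simplex of a subset as a singular simplex of the whole space. -/
def underlyingSimplex {U : Set X} (s : SingularSimplex U n) : SingularSimplex X n :=
  (⟨Subtype.val, continuous_subtype_val⟩ : C(U, X)).comp s

/-- The simplex of the nerve with vertex set `σ`, for a singular simplex `s` lying over `V_σ`. -/
def nerveSimplex {σ : Finset ι} (hcard : σ.card = k + 1) (s : SingularSimplex X n)
    (h : ∀ t, s t ∈ f ⁻¹' nerveSupport V σ) : NSimplex (nerveComplex V) k :=
  ⟨⟨σ, Finset.card_pos.1 (hcard ▸ k.succ_pos), _, h stdSimplex.barycenter⟩, hcard⟩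

theorem isSmallSimplex_of_forall_mem (σ : NSimplex (nerveComplex V) k) {s : SingularSimplex X n}
    (h : ∀ t, s t ∈ f ⁻¹' nerveSupport V σ.1.1) : IsSmallSimplex (fun i => f ⁻¹' V i) s := by
  obtain ⟨i, hi⟩ := σ.1.2.1
  exact ⟨i, fun t => Set.mem_iInter₂.1 (h t) i hi⟩

theorem restrictToVertices_eq_zero_iff {a : SingularCochain R X n} :
    restrictToVertices R f V n a = 0 ↔ VanishesOnSmall (fun i => f ⁻¹' V i) a := by
  constructor
  · rintro h s ⟨i, hi⟩
    have hmem : ∀ t, s t ∈ f ⁻¹' nerveSupport V {i} := fun t =>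
      Set.mem_iInter₂.2 fun j hj => Finset.mem_singleton.1 hj ▸ hi t
    exact congrFun (congrFun h (nerveSimplex (Finset.card_singleton i) s hmem))
      (liftSimplex s hmem)
  · exact fun h => funext fun σ => funext fun s =>
      h _ (isSmallSimplex_of_forall_mem σ fun t => (s t).2)

open Classical in
/-- The values of `c` at a fixed singular simplex `s`, as a function of the simplex of the nerve,
extended by `0` to the finite sets `σ` for which `c σ` cannot be evaluated at `s`. -/
def evalAt (c : SheafCochain (cochainSheaf R f V n) k) (s : SingularSimplex X n)
    (σ : Finset ι) : R :=
  if h : σ.card = k + 1 ∧ ∀ t, s t ∈ f ⁻¹' nerveSupport V σ then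
    c (nerveSimplex h.1 s h.2) (liftSimplex s h.2) else 0

theorem evalAt_underlyingSimplex (c : SheafCochain (cochainSheaf R f V n) k)
    (σ : NSimplex (nerveComplex V) k) (s : SingularSimplex (f ⁻¹' nerveSupport V σ.1.1) n) :
    evalAt c (underlyingSimplex s) σ.1.1 = c σ s :=
  dif_pos ⟨σ.2, fun t => (s t).2⟩

variable [LinearOrder ι]

theorem evalAt_erase (c : SheafCochain (cochainSheaf R f V n) k)
    (τ : NSimplex (nerveComplex V) (k + 1)) (v : τ.1.1)
    (s : SingularSimplex (f ⁻¹' nerveSupport V τ.1.1) n) :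
    evalAt c (underlyingSimplex s) (τ.1.1.erase v) =
      (cochainSheaf R f V n).map (τ.facet_subset v) (c (τ.facet v)) s :=
  evalAt_underlyingSimplex c (τ.facet v) ((ContinuousMap.inclusion
    (Set.preimage_mono (nerveSupport_anti V (τ.facet_subset v)))).comp s)

theorem sheafCoboundary_cochainSheaf_apply (c : SheafCochain (cochainSheaf R f V n) k)
    (τ : NSimplex (nerveComplex V) (k + 1))
    (s : SingularSimplex (f ⁻¹' nerveSupport V τ.1.1) n) :
    sheafCoboundary (cochainSheaf R f V n) k c τ s =
      finsetCoboundary (evalAt c (underlyingSimplex s)) τ.1.1 := by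
  rw [finsetCoboundary, ← Finset.sum_coe_sort]
  refine (Finset.sum_apply s _ _).trans (Finset.sum_congr rfl fun v _ => ?_)
  exact congrArg (incidence τ.1.1 v.1 • ·) (evalAt_erase c τ v s).symm

theorem finsetCoboundary_evalAt_eq_zero {c : SheafCochain (cochainSheaf R f V n) k}
    (hc : sheafCoboundary (cochainSheaf R f V n) k c = 0) {s : SingularSimplex X n}
    {τ : Finset ι} (hcard : τ.card = k + 2) (h : ∀ t, s t ∈ f ⁻¹' nerveSupport V τ) :
    finsetCoboundary (evalAt c s) τ = 0 :=
  (sheafCoboundary_cochainSheaf_apply c (nerveSimplex hcard s h) (liftSimplex s h)).symm.trans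
    (congrFun (congrFun hc _) _)

theorem exists_finsetCoboundary_eq_evalAt {c : SheafCochain (cochainSheaf R f V n) k}
    (hc : sheafCoboundary (cochainSheaf R f V n) k c = 0) (s : SingularSimplex X n) :
    ∃ g : Finset ι → R, ∀ σ : NSimplex (nerveComplex V) k,
      (∀ t, s t ∈ f ⁻¹' nerveSupport V σ.1.1) → finsetCoboundary g σ.1.1 = evalAt c s σ.1.1 := by
  by_cases hs : IsSmallSimplex (fun i => f ⁻¹' V i) s
  · obtain ⟨i, hi⟩ := hs
    refine ⟨finsetCone i (evalAt c s), fun σ hσ => ?_⟩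
    rw [← finsetCoboundary_finsetCone_add i (evalAt c s), left_eq_add, finsetCone]
    split_ifs with hiσ
    · rfl
    rw [finsetCoboundary_evalAt_eq_zero hc, smul_zero]
    · rw [Finset.card_insert_of_notMem hiσ, σ.2]
    · intro t
      rw [nerveSupport, Finset.set_biInter_insert]
      exact ⟨hi t, hσ t⟩
  · exact ⟨0, fun σ hσ => absurd (isSmallSimplex_of_forall_mem σ hσ) hs⟩

theorem exact_restrictToVertices (n : ℕ) :
    Function.Exact (restrictToVertices R f V n) (sheafCoboundary (cochainSheaf R f V n) 0) := by
  intro c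
  constructor
  · intro hc
    choose g hg using exists_finsetCoboundary_eq_evalAt hc
    refine ⟨fun s => g s ∅, funext fun σ => funext fun s => ?_⟩
    rw [← evalAt_underlyingSimplex c, ← hg _ σ fun t => (s t).2,
      finsetCoboundary_of_card_eq_one σ.2]
    rfl
  · rintro ⟨a, rfl⟩
    funext τ s
    have heval : ∀ v ∈ τ.1.1, evalAt (restrictToVertices R f V n a) (underlyingSimplex s)
        (τ.1.1.erase v) = a (underlyingSimplex s) := fun v hv => evalAt_erase _ τ ⟨v, hv⟩ s
    rw [sheafCoboundary_cochainSheaf_apply, finsetCoboundary,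
      Finset.sum_congr rfl fun v hv => congrArg (incidence τ.1.1 v • ·) (heval v hv),
      ← Finset.sum_smul, sum_incidence_of_card_eq_two τ.2, zero_smul, Pi.zero_apply, Pi.zero_apply]

theorem exact_sheafCoboundary_cochainSheaf (k n : ℕ) :
    Function.Exact (sheafCoboundary (cochainSheaf R f V n) k)
      (sheafCoboundary (cochainSheaf R f V n) (k + 1)) := by
  intro c
  constructor
  · intro hc
    choose g hg using exists_finsetCoboundary_eq_evalAt hc
    let b : SheafCochain (cochainSheaf R f V n) k := fun σ s => g (underlyingSimplex s) σ.1.1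
    refine ⟨b, funext fun τ => funext fun s => ?_⟩
    rw [sheafCoboundary_cochainSheaf_apply, ← evalAt_underlyingSimplex c,
      ← hg _ τ fun t => (s t).2]
    exact Finset.sum_congr rfl fun v hv =>
      congrArg (incidence τ.1.1 v • ·) (evalAt_erase b τ ⟨v, hv⟩ s)
  · rintro ⟨b, rfl⟩
    exact sheafCoboundary_comp _ k b

theorem simplexwiseCoboundary_sheafCoboundary (k n : ℕ)
    (c : SheafCochain (cochainSheaf R f V n) k) :
    simplexwiseCoboundary R f V (k + 1) n (sheafCoboundary (cochainSheaf R f V n) k c) =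
      sheafCoboundary (cochainSheaf R f V (n + 1)) k (simplexwiseCoboundary R f V k n c) := by
  funext τ
  change singularCoboundary R _ n (∑ v : τ.1.1, _) = _
  rw [map_sum]
  exact Finset.sum_congr rfl fun v _ => map_zsmul _ _ _

end CechRow

/-! ### The long exact sequence of a cover with one-dimensional nerve -/

section LeraySequence

theorem sheafCoboundary_eq_zero {R : Type*} [CommRing R] {ι : Type*} [LinearOrder ι]
    {K : PreAbstractSimplicialComplex ι} {n : ℕ} (hK : ∀ σ ∈ K, σ.card ≤ n + 1)
    (F : CellularSheaf R K) : sheafCoboundary F n = 0 :=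
  LinearMap.ext fun _ => funext fun τ =>
    absurd (hK τ.1.1 τ.1.2) (by rw [τ.2]; exact Nat.not_succ_le_self _)

variable {R : Type w} [CommRing R] {X : Type u} [TopologicalSpace X] {Y : Type*} {f : X → Y}
  {ι : Type*} {V : ι → Set Y}

variable (R f V) in
/-- Passing to cohomology simplexwise turns the complex of `k`-cochains with values in singular
cochains into the `k`-cochains of the Leray sheaf. -/
def lerayEquiv (k n : ℕ) :
    Cohomology (simplexwiseCoboundary R f V k) n ≃ₗ[R] SheafCochain (leraySheaf R f V n) k :=
  Cohomology.piEquiv (fun σ : NSimplex (nerveComplex V) k =>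
    singularCoboundary R (f ⁻¹' nerveSupport V σ.1.1)) n

theorem simplexwiseCoboundary_comp (k n : ℕ) (c : SheafCochain (cochainSheaf R f V n) k) :
    simplexwiseCoboundary R f V k (n + 1) (simplexwiseCoboundary R f V k n c) = 0 :=
  funext fun σ => singularCoboundary_comp R _ n (c σ)

variable (R f V) in
/-- Restriction of cohomology classes of `X` to the sets `f⁻¹(V_i)`. -/
def cohomologyRestriction (n : ℕ) :
    SingularCohomology R X n →ₗ[R] SheafCochain (leraySheaf R f V n) 0 :=
  LinearMap.pi fun σ => SingularCohomology.map R
    (⟨Subtype.val, continuous_subtype_val⟩ : C(f ⁻¹' nerveSupport V σ.1.1, X)) n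

theorem cohomologyRestriction_eq (n : ℕ) :
    cohomologyRestriction R f V n = (lerayEquiv R f V 0 n).toLinearMap ∘ₗ
      Cohomology.map (singularCoboundary R X) (simplexwiseCoboundary R f V 0)
        (restrictToVertices R f V) (fun _ _ => rfl) n := by
  refine LinearMap.ext fun x => ?_
  obtain ⟨a, rfl⟩ := Cohomology.mk_surjective _ n x
  rfl

variable [LinearOrder ι]

theorem lerayEquiv_map_sheafCoboundary (k n : ℕ) :
    sheafCoboundary (leraySheaf R f V n) k ∘ₗ (lerayEquiv R f V k n).toLinearMap =
      (lerayEquiv R f V (k + 1) n).toLinearMap ∘ₗ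
        Cohomology.map (simplexwiseCoboundary R f V k) (simplexwiseCoboundary R f V (k + 1))
          (fun m => sheafCoboundary (cochainSheaf R f V m) k)
          (simplexwiseCoboundary_sheafCoboundary k) n := by
  refine LinearMap.ext fun x => funext fun τ => ?_
  obtain ⟨z, rfl⟩ := Cohomology.mk_surjective _ n x
  let y (v : τ.1.1) : LinearMap.ker (singularCoboundary R (f ⁻¹' nerveSupport V τ.1.1) n) :=
    cocyclesMap (singularCoboundary R (f ⁻¹' nerveSupport V (τ.facet v).1.1))
      (singularCoboundary R (f ⁻¹' nerveSupport V τ.1.1))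
      (fun m => (cochainSheaf R f V m).map (τ.facet_subset v)) (fun _ _ => rfl) n
      ⟨z.1 (τ.facet v), congrFun z.2 (τ.facet v)⟩
  have hsum : Cohomology.mk (singularCoboundary R (f ⁻¹' nerveSupport V τ.1.1)) n
      (∑ v : τ.1.1, incidence τ.1.1 v.1 • y v) =
        ∑ v : τ.1.1, incidence τ.1.1 v.1 • Cohomology.mk _ n (y v) := by
    rw [map_sum]
    exact Finset.sum_congr rfl fun v _ => map_zsmul _ _ _
  refine hsum.symm.trans (congrArg (Cohomology.mk _ n) (Subtype.ext ?_))
  rw [AddSubmonoidClass.coe_finsetSum]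
  rfl

theorem isQuasiShortExact_restrictToVertices (hopen : ∀ i, IsOpen (f ⁻¹' V i))
    (hcover : Set.range f ⊆ ⋃ i, V i) (hdim : ∀ σ ∈ nerveComplex V, σ.card ≤ 2) :
    IsQuasiShortExact (singularCoboundary R X) (simplexwiseCoboundary R f V 0)
      (simplexwiseCoboundary R f V 1) (restrictToVertices R f V)
      (fun n => sheafCoboundary (cochainSheaf R f V n) 0) := by
  have hcover' : ⋃ i, f ⁻¹' V i = Set.univ := by
    rw [← Set.preimage_iUnion, Set.preimage_eq_univ_iff.2 hcover]
  exact
  { left_comp := singularCoboundary_comp R X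
    mid_comp := simplexwiseCoboundary_comp 0
    left_comm := fun _ _ => rfl
    right_comm := simplexwiseCoboundary_sheafCoboundary 0
    exact := exact_restrictToVertices
    surjective := fun n c => (exact_sheafCoboundary_cochainSheaf 0 n c).1 <| by
      rw [sheafCoboundary_eq_zero hdim, LinearMap.zero_apply]
    acyclic_zero := fun _ hε _ => (restrictToVertices_eq_zero_iff.1 hε).eq_zero_of_zero hcover'
    acyclic_succ := fun _ φ hε hφ => by
      rw [restrictToVertices_eq_zero_iff] at hε
      exact ⟨totalHomotopy φ,
        restrictToVertices_eq_zero_iff.2 (vanishesOnSmall_totalHomotopy hε),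
        hε.singularCoboundary_totalHomotopy hopen hcover' hφ⟩ }

section Cover

variable (hopen : ∀ i, IsOpen (f ⁻¹' V i)) (hcover : Set.range f ⊆ ⋃ i, V i)
  (hdim : ∀ σ ∈ nerveComplex V, σ.card ≤ 2)

include hopen hcover hdim

theorem cohomologyRestriction_zero_injective :
    Function.Injective (cohomologyRestriction R f V 0) := by
  rw [cohomologyRestriction_eq]
  exact (lerayEquiv R f V 0 0).injective.comp
    (isQuasiShortExact_restrictToVertices hopen hcover hdim).map_left_zero_injective

theorem exact_cohomologyRestriction (n : ℕ) :
    Function.Exact (cohomologyRestriction R f V n) (sheafCoboundary (leraySheaf R f V n) 0) := by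
  have h := (isQuasiShortExact_restrictToVertices (R := R) hopen hcover hdim).exact_map_mid n
  refine h.of_ladder_linearEquiv_of_exact (e₁ := LinearEquiv.refl R _) ?_
    (lerayEquiv_map_sheafCoboundary 0 n)
  exact cohomologyRestriction_eq n

theorem exists_exact_sheafCoboundary_cohomologyRestriction (n : ℕ) :
    ∃ b : SheafCochain (leraySheaf R f V n) 1 →ₗ[R] SingularCohomology R X (n + 1),
      Function.Exact (sheafCoboundary (leraySheaf R f V n) 0) b ∧
        Function.Exact b (cohomologyRestriction R f V (n + 1)) := by
  have h := isQuasiShortExact_restrictToVertices (R := R) hopen hcover hdim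
  refine ⟨h.connecting n ∘ₗ (lerayEquiv R f V 1 n).symm.toLinearMap, ?_, ?_⟩
  · refine (h.exact_map_connecting n).of_ladder_linearEquiv_of_exact (e₃ := LinearEquiv.refl R _)
      (lerayEquiv_map_sheafCoboundary 0 n) ?_
    exact LinearMap.ext fun x =>
      congrArg (h.connecting n) ((lerayEquiv R f V 1 n).symm_apply_apply x)
  · rw [cohomologyRestriction_eq, LinearEquiv.precomp_exact_iff_exact,
      LinearEquiv.postcomp_exact_iff_exact]
    exact h.exact_connecting_map n

end Cover

end LeraySequence

theorem isOpen_preimage_of_isOpen_trace {X Y : Type*} [TopologicalSpace X] [TopologicalSpace Y]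
    {f : X → Y} (hf : Continuous f) {V : Set Y} (hV : IsOpen ((↑) ⁻¹' V : Set (Set.range f))) :
    IsOpen (f ⁻¹' V) :=
  hV.preimage (hf.subtype_mk fun x => Set.mem_range_self x)

theorem theorem5p5_general {R : Type*} [CommRing R] {X Y : Type*} [TopologicalSpace X]
    (f : X → Y) {ι : Type*} [LinearOrder ι] (V : ι → Set Y) (hopen : ∀ i, IsOpen (f ⁻¹' V i))
    (hcover : Set.range f ⊆ ⋃ i, V i) (hdim : ∀ σ ∈ nerveComplex V, σ.card ≤ 2) :
    Nonempty (SingularCohomology R X 0 ≃ₗ[R] SheafCohomology (leraySheaf R f V 0) 0) ∧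
    ∀ n : ℕ, ∃ (i : SheafCohomology (leraySheaf R f V n) 1 →ₗ[R] SingularCohomology R X (n + 1))
      (p : SingularCohomology R X (n + 1) →ₗ[R] SheafCohomology (leraySheaf R f V (n + 1)) 0),
      Function.Injective i ∧ Function.Exact i p ∧ Function.Surjective p := by
  have hexact := fun n => exact_cohomologyRestriction (R := R) hopen hcover hdim n
  refine ⟨?_, fun n => ?_⟩
  · obtain ⟨p, hp, hker⟩ := Cohomology.exists_surjective_zero_of_exact (hexact 0)
    have hinj : LinearMap.ker (cohomologyRestriction R f V 0) = ⊥ :=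
      LinearMap.ker_eq_bot.2 (cohomologyRestriction_zero_injective hopen hcover hdim)
    exact ⟨LinearEquiv.ofBijective p ⟨LinearMap.ker_eq_bot.1 (hker.trans hinj), hp⟩⟩
  · obtain ⟨b, hδb, hb⟩ :=
      exists_exact_sheafCoboundary_cohomologyRestriction (R := R) hopen hcover hdim n
    obtain ⟨i, hi, hrange⟩ :=
      Cohomology.exists_injective_one_of_exact hδb (sheafCoboundary_eq_zero hdim _)
    obtain ⟨p, hp, hker⟩ := Cohomology.exists_surjective_zero_of_exact (hexact (n + 1))
    refine ⟨i, p, hi, LinearMap.exact_iff.2 ?_, hp⟩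
    rw [hker, hb.linearMap_ker_eq, hrange]

end

/-- `H⁻¹ = 0`, so in degree `0` the second summand `H¹(N; L⁻¹)` vanishes. The sets `V i` may be
open subsets of `f(X)`, or open subsets of `Y`: only their traces on `f(X)` have to be open. -/
theorem theorem5p5 {R : Type*} [Field R] {X Y : Type*} [TopologicalSpace X] [TopologicalSpace Y]
    (f : X → Y) (hf : Continuous f)
    {ι : Type*} [Finite ι] [LinearOrder ι] (V : ι → Set Y)
    (hopen : ∀ i, IsOpen ((↑) ⁻¹' V i : Set (Set.range f)))
    (hcover : Set.range f ⊆ ⋃ i, V i)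
    (hdim : ∀ σ ∈ nerveComplex V, σ.card ≤ 2) :
    Nonempty (SingularCohomology R X 0 ≃ₗ[R] SheafCohomology (leraySheaf R f V 0) 0) ∧
    ∀ n : ℕ, Nonempty (SingularCohomology R X (n + 1) ≃ₗ[R]
      SheafCohomology (leraySheaf R f V (n + 1)) 0 × SheafCohomology (leraySheaf R f V n) 1) := by
  obtain ⟨hzero, hsucc⟩ := theorem5p5_general (R := R) f V
    (fun i => isOpen_preimage_of_isOpen_trace hf (hopen i)) hcover hdim
  exact ⟨hzero, fun n => (hsucc n).elim fun _ ⟨_, hi, hip, hp⟩ =>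
    nonempty_linearEquiv_prod_of_exact hi hip hp⟩
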